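/- **Theorem 1.3.** For a partial order $\mathbb X$ let $\mathbb P(\mathbb X)=\{f[X] : f:\mathbb X\hookrightarrow\mathbb X \text{ an embedding}\}$ be the set of copies of $\mathbb X$ inside $\mathbb X$, ordered by inclusion. Two elements of a partial order are compatible if they have a common lower bound; an antichain is a set of pairwise incompatible elements, and it is a maximal antichain if every element of the order is compatible with some member of it. A partial order is ultrahomogeneous if each isomorphism between its finite suborders extends to an automorphism. Let $\mathbb X$ be a countably infinite ultrahomogeneous partial order. Then (a) $\mathbb P(\mathbb X)$ has a maximal antichain of cardinality $\mathfrak c=2^{\aleph_0}$; (b) $\mathbb P(\mathbb X)$ has a countably infinite maximal antichain if and only if $\mathbb X$ is isomorphic neither to the countably infinite antichain order $\mathbb A_\omega$ (no two distinct elements comparable) nor to $\mathbb B_\omega$, the disjoint union of $\omega$ copies of $\mathbb Q$ with elements of different copies incomparable. In particular, if $\mathbb D$ is the random poset (the countable ultrahomogeneous partial order into which every countable partial order embeds), then $\mathbb P(\mathbb D)$ has maximal antichains of cardinality $\mathfrak c$ and maximal antichains of cardinality $\aleph_0$. Moreover, there is an order embedding $e:\mathbb Z\to\mathbb D$ whose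 image has neither an upper nor a lower bound in $\mathbb D$ such that the sets $X_m=\{x\in D : x<e(m),\ x\not\le e(m-1)\}$, $m\in\mathbb Z$, are pairwise disjoint copies of $\mathbb D$, their union $X=\bigcup_{m\in\mathbb Z}X_m$ is also a copy of $\mathbb D$, and $\{X_m : m\in\mathbb Z\}$ is a maximal antichain in $\mathbb P(X)$. -/

import Mathlib

universe u

namespace PosetCopies

/-- A partial order is ultrahomogeneous if every isomorphism between finite
suborders extends to an automorphism. -/
def IsUltrahomogeneous (X : Type u) [PartialOrder X] : Prop :=
  ∀ A B : Set X, A.Finite → B.Finite → ∀ φ : A ≃o B,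
    ∃ g : X ≃o X, ∀ a : A, g (a : X) = (φ a : X)

/-- The set `ℙ(X)` of copies of `X` inside `X`: the images of the self-embeddings of `X`.
The coerced type `↥(copies X)` is partially ordered by inclusion. -/
def copies (X : Type u) [PartialOrder X] : Set (Set X) :=
  {A | ∃ f : X ↪o X, Set.range f = A}

/-- Two elements of a partial order are compatible if they have a common lower bound. -/
def Compatible {P : Type u} [PartialOrder P] (x y : P) : Prop :=
  ∃ z : P, z ≤ x ∧ z ≤ y

/-- An antichain in the forcing sense: distinct elements are incompatible. -/
def IsForcingAntichain {P : Type u} [PartialOrder P] (A : Set P) : Prop :=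
  A.Pairwise fun x y => ¬ Compatible x y

/-- A maximal antichain in the forcing sense: an antichain such that every element of the
order is compatible with some member of it. -/
def IsMaximalForcingAntichain {P : Type u} [PartialOrder P] (A : Set P) : Prop :=
  IsForcingAntichain A ∧ ∀ z : P, ∃ x ∈ A, Compatible z x

/-- The carrier of the countably infinite antichain `𝔸_ω`. -/
def AOmega : Type := ℕ

/-- The order of `𝔸_ω`: distinct elements are incomparable. -/
instance : PartialOrder AOmega where
  le a b := a = b
  le_refl _ := rfl
  le_trans _ _ _ := Eq.trans
  le_antisymm _ _ h _ := h

/-- `𝔹_ω`, the disjoint union of countably infinitely many copies of `ℚ`; the order on a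
sigma type is `⟨i, p⟩ ≤ ⟨j, q⟩` iff `i = j` and `p ≤ q`. -/
abbrev BOmega : Type := Σ _ : ℕ, ℚ

/-- `D` is the random poset: a countable ultrahomogeneous partial order into which every
countable partial order embeds. (Every countable partial order has an isomorphic copy in
the lowest universe.) -/
def IsRandomPoset (D : Type u) [PartialOrder D] : Prop :=
  Countable D ∧ IsUltrahomogeneous D ∧
    ∀ (Q : Type) [PartialOrder Q] [Countable Q], Nonempty (Q ↪o D)

/-- For a copy `e` of the integers in `D`, the set
`X_m = {x : x < e m and not x ≤ e (m - 1)}`. -/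
def layer {D : Type u} [PartialOrder D] (e : ℤ ↪o D) (m : ℤ) : Set D :=
  {x | x < e m ∧ ¬ x ≤ e (m - 1)}

end PosetCopies

/-! Copies are incompatible when they lie in sets whose intersection contains no copy. Maximality
comes from Zorn's lemma in (a) and from explicit families in (b).

For (a), continuum many pairwise incompatible copies suffice. `exists_almostDisjoint` gives
continuum many sets with pairwise finite intersections, each meeting countably many prescribed
infinite sets. If every type over a finite set that is realized outside the set is realized
infinitely often, such sets can be made to meet all these types, and extending finite partial
isomorphisms puts a copy inside each. If not, incomparable points have the same points above them,
so the order is pulled back from a dense chain without endpoints, and copies of this chain in almost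
disjoint dense subsets lift.

For (b), `isBidirected_or_isChainSum` says that either any two points are bounded above and below,
or the order is a disjoint sum of chains. In the bidirected case with comparabilities, a cofinal and
coinitial chain of type `ℤ` cuts the order into layers. By density any copy puts a whole interval
into one layer, and every interval contains a copy, so the layers, each split in two, yield the
antichain. If the chains are nontrivial they are copies of `ℚ`. When there are finitely many,
cutting one of them into unit intervals works; when there are infinitely many, or for the infinite
antichain, a diagonal argument defeats every countable family.

For the random poset, a one-point extension property determines the order up to isomorphism. It
passes to each layer and to the union of the layers, which is the complement of the chain. -/

namespace PosetCopies

/-! ### Back-and-forth for countable partial orders -/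

section BackAndForth

variable {α β γ : Type*} [PartialOrder α] [PartialOrder β] [PartialOrder γ]

/-- A finite set of pairs that is (the graph of) an isomorphism between finite suborders. -/
def IsFinPartialIso (s : Finset (α × β)) : Prop :=
  ∀ p ∈ s, ∀ q ∈ s, p.1 ≤ q.1 ↔ p.2 ≤ q.2

/-- `b` stands to the second coordinates of `s` as `a` does to the first coordinates. -/
def Matches (s : Finset (α × β)) (a : α) (b : β) : Prop :=
  ∀ p ∈ s, (p.1 ≤ a ↔ p.2 ≤ b) ∧ (a ≤ p.1 ↔ b ≤ p.2)

variable (α β) in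
/-- Every finite partial isomorphism can be extended to any further point on the left. -/
def ForthProperty : Prop :=
  ∀ s : Finset (α × β), IsFinPartialIso s → ∀ a, ∃ b, Matches s a b

variable (α β) in
/-- Every finite partial isomorphism can be extended to any further point on the right. -/
def BackProperty : Prop :=
  ∀ s : Finset (α × β), IsFinPartialIso s → ∀ b, ∃ a, Matches s a b

theorem IsFinPartialIso.insert [DecidableEq (α × β)] {s : Finset (α × β)}
    (hs : IsFinPartialIso s) {a : α} {b : β} (h : Matches s a b) :
    IsFinPartialIso (insert (a, b) s) := by
  intro p hp q hq
  rcases Finset.mem_insert.1 hp with rfl | hp <;> rcases Finset.mem_insert.1 hq with rfl | hq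
  · simp
  · exact (h q hq).2
  · exact (h p hp).1
  · exact hs p hp q hq

theorem IsFinPartialIso.image {δ : Type*} [PartialOrder δ] [DecidableEq (γ × δ)]
    {s : Finset (α × β)} (hs : IsFinPartialIso s) (f : α ↪o γ) (g : β ↪o δ) :
    IsFinPartialIso (s.image fun p => (f p.1, g p.2)) := by
  intro p hp q hq
  obtain ⟨p, hps, rfl⟩ := Finset.mem_image.1 hp
  obtain ⟨q, hqs, rfl⟩ := Finset.mem_image.1 hq
  simpa using hs p hps q hqs

variable (α β) in
/-- Finite partial isomorphisms, ordered by inclusion. -/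
abbrev FinPartialIso : Type _ := {s : Finset (α × β) // IsFinPartialIso s}

open scoped Classical in
/-- The partial isomorphisms defined at `a`. -/
noncomputable def ForthProperty.cofinal (h : ForthProperty α β) (a : α) :
    Order.Cofinal (FinPartialIso α β) where
  carrier := {s | ∃ b, (a, b) ∈ s.1}
  isCofinal s := by
    obtain ⟨b, hb⟩ := h s.1 s.2 a
    exact ⟨⟨insert (a, b) s.1, s.2.insert hb⟩, ⟨b, Finset.mem_insert_self _ _⟩,
      Finset.subset_insert _ _⟩

open scoped Classical in
/-- The partial isomorphisms with `b` in the range. -/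
noncomputable def BackProperty.cofinal (h : BackProperty α β) (b : β) :
    Order.Cofinal (FinPartialIso α β) where
  carrier := {s | ∃ a, (a, b) ∈ s.1}
  isCofinal s := by
    obtain ⟨a, ha⟩ := h s.1 s.2 b
    exact ⟨⟨insert (a, b) s.1, s.2.insert ha⟩, ⟨a, Finset.mem_insert_self _ _⟩,
      Finset.subset_insert _ _⟩

/-- The empty partial isomorphism. -/
def FinPartialIso.empty : FinPartialIso α β := ⟨∅, by simp [IsFinPartialIso]⟩

/-- An ideal of partial isomorphisms meeting all the cofinal sets is directed, so any two of its
pairs lie in one partial isomorphism and the union is an embedding. -/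
theorem ForthProperty.exists_embedding [Countable α] (h : ForthProperty α β) :
    Nonempty (α ↪o β) := by
  cases nonempty_encodable α
  let I := Order.idealOfCofinals FinPartialIso.empty h.cofinal
  have hI : ∀ a, ∃ b, ∃ s ∈ I, (a, b) ∈ s.1 := by
    intro a
    obtain ⟨s, ⟨b, hb⟩, hs⟩ :=
      Order.cofinal_meets_idealOfCofinals FinPartialIso.empty h.cofinal a
    exact ⟨b, s, hs, hb⟩
  choose f s hs hf using hI
  refine ⟨OrderEmbedding.ofMapLEIff f fun a a' => ?_⟩
  obtain ⟨m, -, h1, h2⟩ := I.directed _ (hs a) _ (hs a')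
  exact (m.2 _ (h1 (hf a)) _ (h2 (hf a'))).symm

theorem exists_orderIso_of_forth_back [Countable α] [Countable β] (h : ForthProperty α β)
    (h' : BackProperty α β) : Nonempty (α ≃o β) := by
  cases nonempty_encodable α
  cases nonempty_encodable β
  let C : α ⊕ β → Order.Cofinal (FinPartialIso α β) := Sum.elim h.cofinal h'.cofinal
  let I := Order.idealOfCofinals FinPartialIso.empty C
  have hI : ∀ a, ∃ b, ∃ s ∈ I, (a, b) ∈ s.1 := by
    intro a
    obtain ⟨s, ⟨b, hb⟩, hs⟩ :=
      Order.cofinal_meets_idealOfCofinals FinPartialIso.empty C (Sum.inl a)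
    exact ⟨b, s, hs, hb⟩
  have hI' : ∀ b, ∃ a, ∃ s ∈ I, (a, b) ∈ s.1 := by
    intro b
    obtain ⟨s, ⟨a, ha⟩, hs⟩ :=
      Order.cofinal_meets_idealOfCofinals FinPartialIso.empty C (Sum.inr b)
    exact ⟨a, s, hs, ha⟩
  have key : ∀ p q : α × β, (∃ s ∈ I, p ∈ s.1) → (∃ s ∈ I, q ∈ s.1) →
      (p.1 ≤ q.1 ↔ p.2 ≤ q.2) := by
    rintro p q ⟨s, hs, hp⟩ ⟨t, ht, hq⟩
    obtain ⟨m, -, h1, h2⟩ := I.directed _ hs _ ht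
    exact m.2 _ (h1 hp) _ (h2 hq)
  choose f hf using hI
  choose g hg using hI'
  refine ⟨⟨⟨f, g, fun a => ?_, fun b => ?_⟩, fun {a a'} => ?_⟩⟩
  · have h1 := key _ _ (hg (f a)) (hf a)
    have h2 := key _ _ (hf a) (hg (f a))
    exact le_antisymm (h1.2 le_rfl) (h2.2 le_rfl)
  · have h1 := key _ _ (hf (g b)) (hg b)
    have h2 := key _ _ (hg b) (hf (g b))
    exact le_antisymm (h1.1 le_rfl) (h2.1 le_rfl)
  · exact (key _ _ (hf a) (hf a')).symm

end BackAndForth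

/-! ### Extending finite tuples to automorphisms -/

section Ultrahomogeneous

variable {X : Type u} [PartialOrder X]

/-- Repetitions in the tuples are harmless: by antisymmetry equalities also correspond, so choosing
an index for each value gives a well-defined isomorphism of ranges. -/
theorem IsUltrahomogeneous.exists_extension (h : IsUltrahomogeneous X) {ι : Type*} [Finite ι]
    (a b : ι → X) (hab : ∀ i j, a i ≤ a j ↔ b i ≤ b j) :
    ∃ g : X ≃o X, ∀ i, g (a i) = b i := by
  have hab' : ∀ i j, a i = a j ↔ b i = b j := fun i j => by
    simp only [le_antisymm_iff, hab]
  have h1 : ∀ x : Set.range a, a x.2.choose = x := fun x => x.2.choose_spec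
  have h2 : ∀ x : Set.range b, b x.2.choose = x := fun x => x.2.choose_spec
  let φ : Set.range a ≃o Set.range b :=
    { toFun := fun x => ⟨b x.2.choose, _, rfl⟩
      invFun := fun x => ⟨a x.2.choose, _, rfl⟩
      left_inv := fun x => Subtype.ext <| by
        conv_rhs => rw [← h1 x]
        exact (hab' _ _).2 (h2 ⟨b x.2.choose, _, rfl⟩)
      right_inv := fun x => Subtype.ext <| by
        conv_rhs => rw [← h2 x]
        exact (hab' _ _).1 (h1 ⟨a x.2.choose, _, rfl⟩)
      map_rel_iff' := fun {x y} => by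
        show b _ ≤ b _ ↔ _
        rw [← hab, h1, h1]
        rfl }
  obtain ⟨g, hg⟩ := h _ _ (Set.finite_range a) (Set.finite_range b) φ
  refine ⟨g, fun i => (hg ⟨a i, i, rfl⟩).trans ?_⟩
  exact (hab' _ _).1 (h1 ⟨a i, i, rfl⟩)

theorem IsUltrahomogeneous.exists_map_eq (h : IsUltrahomogeneous X) (x y : X) :
    ∃ g : X ≃o X, g x = y := by
  obtain ⟨g, hg⟩ := h.exists_extension (fun _ : Unit => x) (fun _ => y) (by simp)
  exact ⟨g, hg ()⟩

theorem IsUltrahomogeneous.exists_map_eq_two (h : IsUltrahomogeneous X) {x y x' y' : X}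
    (h1 : x ≤ y ↔ x' ≤ y') (h2 : y ≤ x ↔ y' ≤ x') : ∃ g : X ≃o X, g x = x' ∧ g y = y' := by
  obtain ⟨g, hg⟩ := h.exists_extension ![x, y] ![x', y'] (by simp [Fin.forall_fin_two, h1, h2])
  exact ⟨g, hg 0, hg 1⟩

theorem IsUltrahomogeneous.exists_map_eq_three (h : IsUltrahomogeneous X) {x y z x' y' z' : X}
    (h1 : x ≤ y ↔ x' ≤ y') (h2 : y ≤ x ↔ y' ≤ x') (h3 : x ≤ z ↔ x' ≤ z') (h4 : z ≤ x ↔ z' ≤ x')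
    (h5 : y ≤ z ↔ y' ≤ z') (h6 : z ≤ y ↔ z' ≤ y') :
    ∃ g : X ≃o X, g x = x' ∧ g y = y' ∧ g z = z' := by
  obtain ⟨g, hg⟩ := h.exists_extension ![x, y, z] ![x', y', z'] (by
    simp [Fin.forall_fin_succ, h1, h2, h3, h4, h5, h6])
  exact ⟨g, hg 0, hg 1, hg 2⟩

theorem IsUltrahomogeneous.exists_extension_matches (h : IsUltrahomogeneous X)
    {s : Finset (X × X)} (hs : IsFinPartialIso s) : ∃ g : X ≃o X, ∀ p ∈ s, g p.1 = p.2 := by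
  obtain ⟨g, hg⟩ := h.exists_extension (fun p : s => p.1.1) (fun p => p.1.2)
    fun p q => hs _ p.2 _ q.2
  exact ⟨g, fun p hp => hg ⟨p, hp⟩⟩

theorem IsUltrahomogeneous.dual (h : IsUltrahomogeneous X) : IsUltrahomogeneous Xᵒᵈ := by
  intro A B hA hB φ
  have : Finite A := hA
  obtain ⟨g, hg⟩ := h.exists_extension (ι := A)
    (fun a => OrderDual.ofDual a.1) (fun a => OrderDual.ofDual (φ a).1)
    fun i j => (φ.le_iff_le (x := j) (y := i)).symm
  exact ⟨g.dual, hg⟩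

end Ultrahomogeneous

/-! ### Compatibility of copies and maximal antichains -/

section Copies

variable {X : Type u} [PartialOrder X]

theorem range_mem_copies (f : X ↪o X) : Set.range f ∈ copies X := ⟨f, rfl⟩

theorem mem_copies_iff {A : Set X} : A ∈ copies X ↔ Nonempty (X ≃o A) := by
  constructor
  · rintro ⟨f, rfl⟩
    exact ⟨f.orderIso⟩
  · rintro ⟨f⟩
    refine ⟨f.toOrderEmbedding.trans (OrderEmbedding.subtype _), ?_⟩
    ext x
    constructor
    · rintro ⟨y, rfl⟩
      exact (f y).2
    · intro hx
      exact ⟨f.symm ⟨x, hx⟩, by simp⟩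

theorem compatible_copies_iff {A B : copies X} :
    Compatible A B ↔ ∃ f : X ↪o X, ∀ x, f x ∈ A.1 ∧ f x ∈ B.1 := by
  constructor
  · rintro ⟨⟨_, f, rfl⟩, hA, hB⟩
    exact ⟨f, fun x => ⟨hA ⟨x, rfl⟩, hB ⟨x, rfl⟩⟩⟩
  · rintro ⟨f, hf⟩
    refine ⟨⟨_, range_mem_copies f⟩, ?_, ?_⟩
    · rintro _ ⟨x, rfl⟩
      exact (hf x).1
    · rintro _ ⟨x, rfl⟩
      exact (hf x).2

theorem Compatible.symm {P : Type u} [PartialOrder P] {x y : P} (h : Compatible x y) :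
    Compatible y x := by
  obtain ⟨z, h1, h2⟩ := h
  exact ⟨z, h2, h1⟩

theorem Compatible.refl {P : Type u} [PartialOrder P] (x : P) : Compatible x x :=
  ⟨x, le_rfl, le_rfl⟩

theorem Compatible.map {P Q : Type*} [PartialOrder P] [PartialOrder Q] (e : P ≃o Q) {x y : P} :
    Compatible (e x) (e y) ↔ Compatible x y := by
  constructor
  · rintro ⟨z, h1, h2⟩
    exact ⟨e.symm z, by simpa [e.symm_apply_le] using h1, by simpa [e.symm_apply_le] using h2⟩
  · rintro ⟨z, h1, h2⟩
    exact ⟨e z, by simpa using h1, by simpa using h2⟩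

/-- Every antichain extends to a maximal one. -/
theorem IsForcingAntichain.exists_maximal {P : Type u} [PartialOrder P] {A : Set P}
    (hA : IsForcingAntichain A) : ∃ B, A ⊆ B ∧ IsMaximalForcingAntichain B := by
  obtain ⟨B, hAB, hB⟩ := zorn_subset_nonempty {B : Set P | IsForcingAntichain B}
    (fun c hc hchain _ => ⟨⋃₀ c, (Set.pairwise_sUnion hchain.directedOn).2 fun s hs => hc hs,
      fun s hs => Set.subset_sUnion_of_mem hs⟩) A hA
  refine ⟨B, hAB, hB.prop, fun z => ?_⟩
  by_contra! hz
  have : IsForcingAntichain (insert z B) :=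
    Set.pairwise_insert.2 ⟨hB.prop, fun b hb _ => ⟨hz b hb, fun h => hz b hb h.symm⟩⟩
  have hzB : z ∈ B := hB.le_of_ge this (Set.subset_insert _ _) (Set.mem_insert _ _)
  exact hz z hzB (Compatible.refl z)

/-- For a countable order, continuum many incompatible copies yield a maximal antichain of
cardinality continuum. -/
theorem exists_maximal_continuum [Countable X] {ι : Type} (hι : Cardinal.mk ι = Cardinal.continuum)
    (C : ι → copies X) (hC : ∀ i j, i ≠ j → ¬ Compatible (C i) (C j)) :
    ∃ 𝒜 : Set (copies X), IsMaximalForcingAntichain 𝒜 ∧ Cardinal.mk 𝒜 = Cardinal.continuum := by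
  have hinj : Function.Injective C := by
    intro i j hij
    by_contra hne
    exact hC i j hne (hij ▸ Compatible.refl _)
  have hanti : IsForcingAntichain (Set.range C) := by
    rintro _ ⟨i, rfl⟩ _ ⟨j, rfl⟩ hne
    exact hC i j fun h => hne (h ▸ rfl)
  obtain ⟨B, hB, hmax⟩ := hanti.exists_maximal
  refine ⟨B, hmax, le_antisymm ?_ ?_⟩
  · calc Cardinal.mk B ≤ Cardinal.mk (copies X) := Cardinal.mk_set_le _
      _ ≤ Cardinal.mk (Set X) := Cardinal.mk_set_le _
      _ = 2 ^ Cardinal.mk X := Cardinal.mk_set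
      _ ≤ 2 ^ Cardinal.aleph0 := Cardinal.power_le_power_left two_ne_zero (Cardinal.mk_le_aleph0)
      _ = Cardinal.continuum := Cardinal.two_power_aleph0
  · have h1 : Cardinal.mk (Set.range C) = Cardinal.continuum := by
      have := Cardinal.mk_range_eq_of_injective hinj
      rw [hι, Cardinal.lift_continuum] at this
      simpa using this
    rw [← h1]
    exact Cardinal.mk_le_mk_of_subset hB

/-- There is a countably infinite maximal antichain of copies, as an injective sequence. -/
def HasCountableMaximalAntichain (X : Type u) [PartialOrder X] : Prop :=
  ∃ A : ℕ → copies X, (∀ i j, i ≠ j → ¬ Compatible (A i) (A j)) ∧ ∀ Z, ∃ i, Compatible Z (A i)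

theorem hasCountableMaximalAntichain_iff :
    HasCountableMaximalAntichain X ↔
      ∃ 𝒜 : Set (copies X), IsMaximalForcingAntichain 𝒜 ∧ Cardinal.mk 𝒜 = Cardinal.aleph0 := by
  constructor
  · rintro ⟨A, hA, hmax⟩
    have hinj : Function.Injective A := by
      intro i j hij
      by_contra hne
      exact hA i j hne (hij ▸ Compatible.refl _)
    refine ⟨Set.range A, ⟨?_, ?_⟩, ?_⟩
    · rintro _ ⟨i, rfl⟩ _ ⟨j, rfl⟩ hne
      exact hA i j fun h => hne (h ▸ rfl)
    · intro Z
      obtain ⟨i, hi⟩ := hmax Z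
      exact ⟨_, ⟨i, rfl⟩, hi⟩
    · have := Cardinal.mk_range_eq_of_injective hinj
      simpa using this
  · rintro ⟨𝒜, ⟨h1, h2⟩, h3⟩
    obtain ⟨hc⟩ := Cardinal.denumerable_iff.2 h3
    let e := (Denumerable.eqv 𝒜).symm
    refine ⟨fun i => e i, fun i j hij => h1 (e i).2 (e j).2 ?_, fun Z => ?_⟩
    · exact fun h => hij (e.injective (Subtype.ext h))
    · obtain ⟨x, hx, hZ⟩ := h2 Z
      exact ⟨e.symm ⟨x, hx⟩, by simpa using hZ⟩

/-- Transport of copies along an isomorphism. -/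
theorem image_mem_copies {X Y : Type*} [PartialOrder X] [PartialOrder Y] (e : X ≃o Y) {A : Set X}
    (hA : A ∈ copies X) : e '' A ∈ copies Y := by
  obtain ⟨f, rfl⟩ := hA
  refine ⟨(e.symm.toOrderEmbedding.trans f).trans e.toOrderEmbedding, ?_⟩
  ext y
  constructor
  · rintro ⟨x, rfl⟩
    exact ⟨_, ⟨e.symm x, rfl⟩, rfl⟩
  · rintro ⟨_, ⟨x, rfl⟩, rfl⟩
    exact ⟨e x, by simp⟩

/-- An isomorphism of orders induces an isomorphism of the orders of copies. -/
noncomputable def copiesCongr {X Y : Type*} [PartialOrder X] [PartialOrder Y] (e : X ≃o Y) :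
    copies X ≃o copies Y where
  toFun A := ⟨e '' A, image_mem_copies e A.2⟩
  invFun A := ⟨e.symm '' A, image_mem_copies e.symm A.2⟩
  left_inv A := Subtype.ext (e.symm_image_image A)
  right_inv A := Subtype.ext (e.image_symm_image A)
  map_rel_iff' := Set.image_subset_image_iff e.injective

theorem HasCountableMaximalAntichain.congr {X Y : Type*} [PartialOrder X] [PartialOrder Y]
    (e : X ≃o Y) (h : HasCountableMaximalAntichain X) : HasCountableMaximalAntichain Y := by
  obtain ⟨A, hA, hmax⟩ := h
  refine ⟨fun i => copiesCongr e (A i), fun i j hij => ?_, fun Z => ?_⟩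
  · rw [Compatible.map]
    exact hA i j hij
  · obtain ⟨i, hi⟩ := hmax ((copiesCongr e).symm Z)
    refine ⟨i, ?_⟩
    rw [← Compatible.map (copiesCongr e)] at hi
    simpa using hi

end Copies

/-! ### The dichotomy: bidirected orders and sums of chains -/

section Structure

variable {X : Type u} [PartialOrder X]

theorem IsUltrahomogeneous.noMaxOrder (h : IsUltrahomogeneous X) (hlt : ∃ a b : X, a < b) :
    NoMaxOrder X := by
  obtain ⟨a, b, hab⟩ := hlt
  refine ⟨fun x => ?_⟩
  obtain ⟨g, rfl⟩ := h.exists_map_eq a x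
  exact ⟨g b, g.lt_iff_lt.2 hab⟩

theorem IsUltrahomogeneous.noMinOrder (h : IsUltrahomogeneous X) (hlt : ∃ a b : X, a < b) :
    NoMinOrder X := by
  obtain ⟨a, b, hab⟩ := hlt
  refine ⟨fun x => ?_⟩
  obtain ⟨g, rfl⟩ := h.exists_map_eq b x
  exact ⟨g a, g.lt_iff_lt.2 hab⟩

theorem IsUltrahomogeneous.denselyOrdered (h : IsUltrahomogeneous X) : DenselyOrdered X := by
  refine ⟨fun x y hxy => ?_⟩
  have := h.noMaxOrder ⟨x, y, hxy⟩
  obtain ⟨z, hz⟩ := exists_gt y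
  -- Compress `x < y < z` by fixing `x` and sending `z` to `y`; the image of `y` falls strictly
  -- between.
  obtain ⟨g, h1, h2⟩ := h.exists_map_eq_two (x := x) (y := z) (x' := x) (y' := y)
    (by simp [hxy.le, (hxy.trans hz).le]) (by simp [hxy.not_ge, (hxy.trans hz).not_ge])
  exact ⟨g y, by simpa [h1] using g.lt_iff_lt.2 hxy, by simpa [h2] using g.lt_iff_lt.2 hz⟩

/-- If the elements below each point form a chain, then so do the elements above each point. -/
theorem IsUltrahomogeneous.comparable_of_le_of_le (h : IsUltrahomogeneous X)
    (hΛ : ∀ a b c : X, a ≤ c → b ≤ c → a ≤ b ∨ b ≤ a) (b c d : X) (hdb : d ≤ b) (hdc : d ≤ c) :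
    b ≤ c ∨ c ≤ b := by
  by_contra! hbc
  obtain ⟨h1, h2⟩ := hbc
  have hdb' : d < b := lt_of_le_of_ne hdb (by rintro rfl; exact h1 hdc)
  have := h.noMaxOrder ⟨d, b, hdb'⟩
  obtain ⟨b', hb'⟩ := exists_gt b
  have h1' : ¬ b' ≤ c := fun h' => h1 (hb'.le.trans h')
  have h2' : ¬ c ≤ b' := fun h' => (hΛ b c b' hb'.le h').elim h1 h2
  -- Raising `d` to `b` while fixing `b'` makes `g c` lie above `b`, and `b'`, `c`, `g c` turn out
  -- to be pairwise incomparable.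
  obtain ⟨g, hgd, hgb⟩ := h.exists_map_eq_two (x := d) (y := b') (x' := b) (y' := b')
    (by simp [hb'.le, (hdb'.trans hb').le]) (by simp [hb'.not_ge, (hdb'.trans hb').not_ge])
  have hbe : b ≤ g c := by rw [← hgd]; exact g.le_iff_le.2 hdc
  have h3 : ¬ g c ≤ b' := by rw [← hgb, g.le_iff_le]; exact h2'
  have h4 : ¬ b' ≤ g c := by rw [← hgb, g.le_iff_le]; exact h1'
  have h5 : ¬ g c ≤ c := fun h' => h1 (hbe.trans h')
  have h6 : ¬ c ≤ g c := fun h' => (hΛ b c _ hbe h').elim h1 h2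
  -- Swap `b'` and `c`, fixing `g c`. Then `b` and `k b` both lie below `g c`, so they are
  -- comparable, but `b` is below `b'` and not `c`, while `k b` is below `c` and not `b'`.
  obtain ⟨k, hk1, hk2, hk3⟩ := h.exists_map_eq_three (x := b') (y := c) (z := g c)
    (x' := c) (y' := b') (z' := g c) (by simp [h1', h2']) (by simp [h1', h2'])
    (by simp [h4, h6]) (by simp [h3, h5]) (by simp [h4, h6]) (by simp [h3, h5])
  have h7 : k b ≤ c := by rw [← hk1]; exact k.le_iff_le.2 hb'.le
  have h8 : k b ≤ g c := by rw [← hk3]; exact k.le_iff_le.2 hbe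
  have h9 : ¬ k b ≤ b' := by rw [← hk2, k.le_iff_le]; exact h1
  rcases hΛ _ _ _ hbe h8 with h' | h'
  · exact h1 (h'.trans h7)
  · exact h9 (h'.trans hb'.le)

/-- Any two points are bounded above and below. -/
def IsBidirected (X : Type*) [PartialOrder X] : Prop :=
  (∀ a b : X, ∃ c, a ≤ c ∧ b ≤ c) ∧ ∀ a b : X, ∃ c, c ≤ a ∧ c ≤ b

/-- Points with a common upper bound or a common lower bound are comparable. -/
def IsChainSum (X : Type*) [PartialOrder X] : Prop :=
  (∀ a b c : X, a ≤ c → b ≤ c → a ≤ b ∨ b ≤ a) ∧ ∀ a b c : X, c ≤ a → c ≤ b → a ≤ b ∨ b ≤ a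

theorem IsUltrahomogeneous.isBidirected_or_isChainSum (h : IsUltrahomogeneous X) :
    IsBidirected X ∨ IsChainSum X := by
  by_cases hΛ : ∀ a b c : X, a ≤ c → b ≤ c → a ≤ b ∨ b ≤ a
  · exact Or.inr ⟨hΛ, h.comparable_of_le_of_le hΛ⟩
  by_cases hV : ∀ a b c : X, c ≤ a → c ≤ b → a ≤ b ∨ b ≤ a
  · exact absurd (fun a b c hac hbc =>
      (h.dual.comparable_of_le_of_le (fun a b c hac hbc => (hV a b c hac hbc).symm) a b c
        hac hbc).symm) hΛ
  push Not at hΛ hV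
  left
  constructor
  · intro a b
    by_cases hab : a ≤ b
    · exact ⟨b, hab, le_rfl⟩
    by_cases hba : b ≤ a
    · exact ⟨a, le_rfl, hba⟩
    obtain ⟨p, q, r, h1, h2, h3, h4⟩ := hΛ
    obtain ⟨g, rfl, rfl⟩ := h.exists_map_eq_two (x := p) (y := q) (x' := a) (y' := b)
      (by simp [*]) (by simp [*])
    exact ⟨g r, by simpa using h1, by simpa using h2⟩
  · intro a b
    by_cases hab : a ≤ b
    · exact ⟨a, le_rfl, hab⟩
    by_cases hba : b ≤ a
    · exact ⟨b, hba, le_rfl⟩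
    obtain ⟨p, q, r, h1, h2, h3, h4⟩ := hV
    obtain ⟨g, rfl, rfl⟩ := h.exists_map_eq_two (x := p) (y := q) (x' := a) (y' := b)
      (by simp [*]) (by simp [*])
    exact ⟨g r, by simpa using h1, by simpa using h2⟩

theorem IsBidirected.dual (h : IsBidirected X) : IsBidirected Xᵒᵈ := ⟨h.2, h.1⟩

theorem IsBidirected.exists_gt_finset (h : IsBidirected X) [NoMaxOrder X] [Nonempty X]
    (F : Finset X) : ∃ b, ∀ x ∈ F, x < b := by
  have : IsDirectedOrder X := ⟨h.1⟩
  obtain ⟨c, hc⟩ := F.exists_le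
  obtain ⟨b, hb⟩ := exists_gt c
  exact ⟨b, fun x hx => (hc x hx).trans_lt hb⟩

theorem IsBidirected.exists_lt_finset (h : IsBidirected X) [NoMinOrder X] [Nonempty X]
    (F : Finset X) : ∃ b, ∀ x ∈ F, b < x :=
  h.dual.exists_gt_finset (X := Xᵒᵈ) F

open scoped Classical in
/-- In a bidirected ultrahomogeneous order, every interval contains a copy of the order. -/
theorem IsUltrahomogeneous.forthProperty_Ioo (h : IsUltrahomogeneous X) (hd : IsBidirected X)
    {x y : X} (hxy : x < y) : ForthProperty X (Set.Ioo x y) := by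
  intro s hs p
  have := h.noMaxOrder ⟨x, y, hxy⟩
  have := h.noMinOrder ⟨x, y, hxy⟩
  have : Nonempty X := ⟨x⟩
  -- Bounds `a` and `b` of the domain and `p` are sent to `x` and `y`, which forces the image of `p`
  -- into the interval.
  obtain ⟨b, hb⟩ := hd.exists_gt_finset (insert p (s.image Prod.fst))
  obtain ⟨a, ha⟩ := hd.exists_lt_finset (insert p (s.image Prod.fst))
  simp only [Finset.mem_insert, Finset.mem_image, forall_eq_or_imp, forall_exists_index,
    and_imp, forall_apply_eq_imp_iff₂] at ha hb
  let t : Finset (X × X) := s.image fun p => (p.1, p.2.1)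
  have ht : IsFinPartialIso t :=
    hs.image (RelEmbedding.refl _) (OrderEmbedding.subtype _)
  have ht1 : IsFinPartialIso (insert (b, y) t) := ht.insert fun q hq => by
    obtain ⟨q, hqs, rfl⟩ := Finset.mem_image.1 hq
    simp [(hb.2 q hqs).le, q.2.2.2.le, (hb.2 q hqs).not_ge, q.2.2.2.not_ge]
  have ht2 : IsFinPartialIso (insert (a, x) (insert (b, y) t)) := ht1.insert fun q hq => by
    rcases Finset.mem_insert.1 hq with rfl | hq
    · simp [hxy.le, (ha.1.trans hb.1).le, hxy.not_ge, (ha.1.trans hb.1).not_ge]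
    obtain ⟨q, hqs, rfl⟩ := Finset.mem_image.1 hq
    simp [(ha.2 q hqs).le, q.2.2.1.le, (ha.2 q hqs).not_ge, q.2.2.1.not_ge]
  obtain ⟨g, hg⟩ := h.exists_extension_matches ht2
  have hgx : g a = x := hg (a, x) (by simp)
  have hgy : g b = y := hg (b, y) (by simp)
  have hgs : ∀ q ∈ s, g q.1 = q.2.1 := fun q hq =>
    hg (q.1, q.2.1) (by simp only [Finset.mem_insert]; exact Or.inr (Or.inr
      (Finset.mem_image.2 ⟨q, hq, rfl⟩)))
  refine ⟨⟨g p, ?_, ?_⟩, fun q hq => ?_⟩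
  · rw [← hgx]; exact g.lt_iff_lt.2 ha.1
  · rw [← hgy]; exact g.lt_iff_lt.2 hb.1
  · simp only [← Subtype.coe_le_coe]
    rw [← hgs q hq]
    simp

/-- The points having the same relations to the elements of `C` as `x`. -/
def typeSet (C : Finset X) (x : X) : Set X :=
  {y | ∀ c ∈ C, (y ≤ c ↔ x ≤ c) ∧ (c ≤ y ↔ c ≤ x)}

theorem mem_typeSet {C : Finset X} {x y : X} :
    y ∈ typeSet C x ↔ ∀ c ∈ C, (y ≤ c ↔ x ≤ c) ∧ (c ≤ y ↔ c ≤ x) := Iff.rfl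

open scoped Classical in
-- All points of the type relate to `C` identically, so `s` can be joined with the identity on `C`;
-- an automorphism fixing `C` pointwise preserves the type.
theorem IsUltrahomogeneous.exists_extension_typeSet (h : IsUltrahomogeneous X) (C : Finset X)
    (x : X) {s : Finset (X × X)} (hs : IsFinPartialIso s)
    (hsx : ∀ p ∈ s, p.1 ∈ typeSet C x ∧ p.2 ∈ typeSet C x) :
    ∃ g : X ≃o X, (∀ p ∈ s, g p.1 = p.2) ∧ ∀ y ∈ typeSet C x, g y ∈ typeSet C x := by
  have ht : IsFinPartialIso (s ∪ C.image fun c => (c, c)) := by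
    intro p hp q hq
    rcases Finset.mem_union.1 hp with hp | hp <;> rcases Finset.mem_union.1 hq with hq | hq
    · exact hs p hp q hq
    · obtain ⟨c, hc, rfl⟩ := Finset.mem_image.1 hq
      exact (((hsx p hp).1 c hc).1).trans (((hsx p hp).2 c hc).1).symm
    · obtain ⟨c, hc, rfl⟩ := Finset.mem_image.1 hp
      exact (((hsx q hq).1 c hc).2).trans (((hsx q hq).2 c hc).2).symm
    · obtain ⟨c, hc, rfl⟩ := Finset.mem_image.1 hp
      obtain ⟨d, hd, rfl⟩ := Finset.mem_image.1 hq
      rfl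
  obtain ⟨g, hg⟩ := h.exists_extension_matches ht
  refine ⟨g, fun p hp => hg p (Finset.mem_union_left _ hp), fun y hy c hc => ?_⟩
  have hgc : g c = c := hg (c, c) (Finset.mem_union_right _ (Finset.mem_image.2 ⟨c, hc, rfl⟩))
  rw [← hy c hc |>.1, ← hy c hc |>.2]
  constructor
  · conv_lhs => rw [← hgc]
    simp
  · conv_lhs => rw [← hgc]
    simp

open scoped Classical in
/-- A complete type over a finite set that contains a copy of the order is itself a copy. -/
theorem IsUltrahomogeneous.typeSet_mem_copies [Countable X] (h : IsUltrahomogeneous X)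
    (C : Finset X) (x : X) (f : X ↪o X) (hf : ∀ y, f y ∈ typeSet C x) :
    typeSet C x ∈ copies X := by
  rw [mem_copies_iff]
  refine exists_orderIso_of_forth_back ?_ ?_
  · intro s hs a
    have ht : IsFinPartialIso (s.image fun p => (f p.1, p.2.1)) :=
      hs.image f (OrderEmbedding.subtype _)
    obtain ⟨g, hg, hgT⟩ := h.exists_extension_typeSet C x ht (by
      simp only [Finset.mem_image]
      rintro _ ⟨p, -, rfl⟩
      exact ⟨hf _, p.2.2⟩)
    refine ⟨⟨g (f a), hgT _ (hf a)⟩, fun p hp => ?_⟩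
    have : g (f p.1) = p.2.1 := hg (f p.1, p.2.1) (Finset.mem_image.2 ⟨p, hp, rfl⟩)
    simp only [← Subtype.coe_le_coe]
    rw [← this]
    simp
  · intro s hs b
    have ht : IsFinPartialIso (s.image fun p => (p.1, p.2.1)) :=
      hs.image (RelEmbedding.refl _) (OrderEmbedding.subtype _)
    obtain ⟨g, hg⟩ := h.exists_extension_matches ht
    refine ⟨g.symm b, fun p hp => ?_⟩
    have : g p.1 = p.2.1 := hg (p.1, p.2.1) (Finset.mem_image.2 ⟨p, hp, rfl⟩)
    simp only [← Subtype.coe_le_coe]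
    rw [← this, g.le_symm_apply, g.symm_apply_le]
    simp

end Structure

/-! ### Layers along an unbounded chain, and the bidirected case -/

section Layers

variable {X : Type u} [PartialOrder X]

theorem exists_strictMono_cofinal [Countable X] [NoMaxOrder X]
    (hd : ∀ a b : X, ∃ c, a ≤ c ∧ b ≤ c) (x : X) :
    ∃ f : ℕ → X, StrictMono f ∧ f 0 = x ∧ ∀ y, ∃ n, y ≤ f n := by
  have : Nonempty X := ⟨x⟩
  obtain ⟨q, hq⟩ := exists_surjective_nat X
  have hstep : ∀ (a b : X), ∃ c, a < c ∧ b ≤ c := fun a b => by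
    obtain ⟨c, h1, h2⟩ := hd a b
    obtain ⟨d, hd⟩ := exists_gt c
    exact ⟨d, h1.trans_lt hd, h2.trans hd.le⟩
  choose s hs1 hs2 using hstep
  let f : ℕ → X := fun n => Nat.rec x (fun n y => s y (q n)) n
  refine ⟨f, strictMono_nat_of_lt_succ fun n => hs1 _ _, rfl, fun y => ?_⟩
  obtain ⟨n, rfl⟩ := hq y
  exact ⟨n + 1, hs2 _ _⟩

/-- A copy of the integers that is unbounded in the strong sense. -/
def IsCofinalChain (e : ℤ ↪o X) : Prop :=
  (∀ x, ∃ m, x ≤ e m) ∧ ∀ x, ∃ m, e m ≤ x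

theorem IsBidirected.exists_isCofinalChain [Countable X] [Nonempty X] [NoMaxOrder X] [NoMinOrder X]
    (hd : IsBidirected X) : ∃ e : ℤ ↪o X, IsCofinalChain e := by
  obtain ⟨x⟩ := ‹Nonempty X›
  obtain ⟨f, hf, hf0, hfc⟩ := exists_strictMono_cofinal hd.1 x
  have : Countable Xᵒᵈ := ‹Countable X›
  obtain ⟨g, hg, hg0, hgc⟩ := exists_strictMono_cofinal (X := Xᵒᵈ) hd.dual.1 (OrderDual.toDual x)
  -- `Int.negSucc n` is `-(n + 1)`, hence the shift; `f 0` and `g 0` are both `x`, counted once.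
  let e : ℤ → X := fun n => Int.casesOn n f (fun n => OrderDual.ofDual (g (n + 1)))
  have he : StrictMono e := by
    refine strictMono_int_of_lt_succ fun n => ?_
    cases n with
    | ofNat n => exact hf (Nat.lt_succ_self n)
    | negSucc n =>
      cases n with
      | zero =>
        show OrderDual.ofDual (g 1) < f 0
        rw [hf0]
        have := hg (zero_lt_one)
        rw [hg0] at this
        exact this
      | succ n => exact hg (Nat.lt_succ_self _)
  have hcmp : ∀ a b, a ≤ b ↔ e a ≤ e b := fun a b => by
    rcases lt_trichotomy a b with hab | rfl | hab
    · simp [hab.le, (he hab).le]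
    · simp
    · simp [hab.not_ge, (he hab).not_ge]
  refine ⟨OrderEmbedding.ofMapLEIff e fun a b => (hcmp a b).symm, fun y => ?_, fun y => ?_⟩
  · obtain ⟨n, hn⟩ := hfc y
    exact ⟨n, hn⟩
  · obtain ⟨n, hn⟩ := hgc (OrderDual.toDual y)
    exact ⟨Int.negSucc n, (hg (Nat.lt_succ_self n)).le.trans' hn⟩

theorem IsCofinalChain.exists_least {e : ℤ ↪o X} (he : IsCofinalChain e) :
    ∃ μ : X → ℤ, ∀ x, x ≤ e (μ x) ∧ ∀ m, x ≤ e m → μ x ≤ m := by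
  have : ∀ x, ∃ k, x ≤ e k ∧ ∀ m, x ≤ e m → k ≤ m := by
    intro x
    obtain ⟨m, hm⟩ := he.2 x
    exact Int.exists_least_of_bdd ⟨m, fun k hk => e.le_iff_le.1 (hm.trans hk)⟩ (he.1 x)
  exact Classical.axiom_of_choice this

theorem disjoint_layer (e : ℤ ↪o X) {m n : ℤ} (hmn : m ≠ n) :
    Disjoint (layer e m) (layer e n) := by
  wlog h : m < n generalizing m n
  · exact (this hmn.symm (lt_of_le_of_ne (not_lt.1 h) hmn.symm)).symm
  rw [Set.disjoint_left]
  exact fun x hx hx' => hx'.2 (hx.1.le.trans (e.le_iff_le.2 (by omega)))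

/-- An embedding of a dense order takes some three-element chain into a single layer. -/
theorem IsCofinalChain.exists_chain_mem_layer {e : ℤ ↪o X} (he : IsCofinalChain e) {P : Type*}
    [PartialOrder P] [DenselyOrdered P] (f : P ↪o X) {a b : P} (hab : a < b) :
    ∃ m, ∃ x y z : P, x < y ∧ y < z ∧ f x ∈ layer e m ∧ f y ∈ layer e m ∧ f z ∈ layer e m := by
  obtain ⟨μ, hμ⟩ := he.exists_least
  have hmono : ∀ x y, x ≤ y → μ x ≤ μ y := fun x y hxy => (hμ x).2 _ (hxy.trans (hμ y).1)
  induction hk : (μ (f b) - μ (f a)).toNat using Nat.strong_induction_on generalizing a with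
  | _ k ih =>
    obtain ⟨z, haz, hzb⟩ := exists_between hab
    obtain ⟨y, hay, hyz⟩ := exists_between haz
    obtain ⟨x, hax, hxy⟩ := exists_between hay
    have h1 := hmono _ _ (f.le_iff_le.2 haz.le)
    have h2 := hmono _ _ (f.le_iff_le.2 hzb.le)
    by_cases heq : μ (f a) = μ (f z)
    -- The endpoint `z` is left out because `f z` may equal the chain point, whereas a layer lies
    -- strictly below it.
    · have key : ∀ w, a ≤ w → w < z → f w ∈ layer e (μ (f a)) := by
        intro w haw hwz
        refine ⟨?_, fun hw => ?_⟩
        · rw [heq]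
          exact (f.lt_iff_lt.2 hwz).trans_le (hμ _).1
        · have := (hμ _).2 _ ((f.le_iff_le.2 haw).trans hw)
          omega
      exact ⟨_, a, x, y, hax, hxy, key a le_rfl haz, key x hax.le (hxy.trans hyz),
        key y hay.le hyz⟩
    -- Here `μ (f a) < μ (f z)`, so passing to `z < b` lowers the gap.
    · exact ih _ (by omega) hzb rfl

open scoped Classical in
theorem IsUltrahomogeneous.hasCountableMaximalAntichain_of_isBidirected [Countable X]
    (h : IsUltrahomogeneous X) (hlt : ∃ a b : X, a < b) (hd : IsBidirected X) :
    HasCountableMaximalAntichain X := by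
  have := h.noMaxOrder hlt
  have := h.noMinOrder hlt
  have := h.denselyOrdered
  obtain ⟨a₀, b₀, hab₀⟩ := hlt
  have : Nonempty X := ⟨a₀⟩
  obtain ⟨e, he⟩ := hd.exists_isCofinalChain
  have hstep : ∀ m : ℤ, e (m - 1) < e m := fun m => e.lt_iff_lt.2 (by omega)
  have hIoo : ∀ {x y : X}, x < y → ∃ f : X ↪o X, ∀ z, f z ∈ Set.Ioo x y := fun hxy => by
    obtain ⟨f⟩ := (h.forthProperty_Ioo hd hxy).exists_embedding
    exact ⟨f.trans (OrderEmbedding.subtype _), fun z => (f z).2⟩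
  -- A layer splits into the points above `e (m - 1)` and those incomparable to it. Each nonempty
  -- piece is a complete type over two chain points, so it is a copy as soon as it contains one.
  let T : ℤ × Prop → Set X := fun i => {x | x ∈ layer e i.1 ∧ (e (i.1 - 1) ≤ x ↔ i.2)}
  have hT : ∀ i j x, x ∈ T i → x ∈ T j → i = j := by
    rintro ⟨m, p⟩ ⟨n, q⟩ x ⟨hx1, hx2⟩ ⟨hx3, hx4⟩
    by_cases hmn : m = n
    · subst hmn
      exact Prod.ext rfl (propext (hx2.symm.trans hx4))
    · exact (Set.disjoint_left.1 (disjoint_layer e hmn) hx1 hx3).elim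
  have hTtype : ∀ i, ∀ x ∈ T i, T i = typeSet {e (i.1 - 1), e i.1} x := by
    rintro ⟨m, p⟩ x ⟨⟨hx1, hx2⟩, hx3⟩
    ext y
    simp only [mem_typeSet, Finset.mem_insert, Finset.mem_singleton, forall_eq_or_imp, forall_eq]
    simp only at hx1 hx2 hx3
    constructor
    · rintro ⟨⟨hy1, hy2⟩, hy3⟩
      simp only at hy1 hy2 hy3
      simp [*, hx1.le, hy1.le, hx1.not_ge, hy1.not_ge]
    · rintro ⟨⟨h1, h2⟩, ⟨h3, h4⟩⟩
      refine ⟨⟨lt_of_le_not_ge (h3.2 hx1.le) (fun h' => hx1.not_ge (h4.1 h')), ?_⟩, ?_⟩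
      · exact fun h' => hx2 (h1.1 h')
      · exact h2.trans hx3
  have hTcopy : ∀ i (f : X ↪o X), (∀ x, f x ∈ T i) → T i ∈ copies X := by
    intro i f hf
    have h1 := hTtype i _ (hf a₀)
    rw [h1]
    exact h.typeSet_mem_copies _ _ f fun x => h1 ▸ hf x
  have hTtrue : ∀ m, T (m, True) ∈ copies X := by
    intro m
    obtain ⟨f, hf⟩ := hIoo (hstep m)
    refine hTcopy _ f fun x => ⟨⟨(hf x).2, (hf x).1.not_ge⟩, ?_⟩
    simp [(hf x).1.le]
  -- Only the pieces that are copies are kept; the incomparable pieces need not be, while the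
  -- intervals alone already make the family infinite.
  let 𝒜 : Set (copies X) := {A | A.1 ∈ Set.range T}
  have hcount : 𝒜.Countable := (Set.countable_range T).preimage Subtype.val_injective
  have hinf : 𝒜.Infinite := by
    refine Set.infinite_of_injective_forall_mem (f := fun m : ℤ => (⟨_, hTtrue m⟩ : copies X)) ?_
      (fun m => ⟨_, rfl⟩)
    intro m n hmn
    obtain ⟨f, hf⟩ := hTtrue m
    have h1 : f a₀ ∈ T (m, True) := hf ▸ ⟨a₀, rfl⟩
    have h2 : f a₀ ∈ T (n, True) := by
      have : T (m, True) = T (n, True) := congrArg Subtype.val hmn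
      rwa [← this]
    exact congrArg Prod.fst (hT _ _ _ h1 h2)
  rw [hasCountableMaximalAntichain_iff]
  have := hcount.to_subtype
  have := hinf.to_subtype
  refine ⟨𝒜, ⟨?_, ?_⟩, Cardinal.mk_eq_aleph0 _⟩
  · rintro ⟨A, hA⟩ ⟨i, rfl⟩ ⟨B, hB⟩ ⟨j, rfl⟩ hne hcomp
    obtain ⟨f, hf⟩ := compatible_copies_iff.1 hcomp
    obtain rfl := hT i j _ (hf a₀).1 (hf a₀).2
    exact hne rfl
  · rintro ⟨_, f, rfl⟩
    obtain ⟨m, x, y, z, hxy, hyz, hx, hy, hz⟩ := he.exists_chain_mem_layer f hab₀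
    -- If so, the interval from `y` to `z` maps into the upper piece; if not, the one from `x` to
    -- `y` maps into the incomparable piece.
    by_cases hcase : e (m - 1) ≤ f y
    · obtain ⟨k, hk⟩ := hIoo hyz
      refine ⟨⟨_, hTtrue m⟩, ⟨_, rfl⟩, compatible_copies_iff.2 ⟨k.trans f, fun w => ⟨⟨_, rfl⟩, ?_⟩⟩⟩
      have h1 : f y < f (k w) := f.lt_iff_lt.2 (hk w).1
      have h2 : f (k w) < f z := f.lt_iff_lt.2 (hk w).2
      exact ⟨⟨h2.trans hz.1, (hcase.trans_lt h1).not_ge⟩, by simpa using hcase.trans h1.le⟩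
    · obtain ⟨k, hk⟩ := hIoo hxy
      have hmem : ∀ w, (k.trans f) w ∈ T (m, False) := by
        intro w
        have h1 : f x < f (k w) := f.lt_iff_lt.2 (hk w).1
        have h2 : f (k w) < f y := f.lt_iff_lt.2 (hk w).2
        exact ⟨⟨h2.trans hy.1, fun h' => hx.2 (h1.le.trans h')⟩,
          by simpa using fun h' => hcase (le_trans h' h2.le)⟩
      exact ⟨⟨_, hTcopy _ _ hmem⟩, ⟨_, rfl⟩,
        compatible_copies_iff.2 ⟨k.trans f, fun w => ⟨⟨_, rfl⟩, hmem w⟩⟩⟩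

end Layers

/-! ### Disjoint sums of chains -/

section Sigma

variable {ι κ L M : Type*} [LinearOrder L] [LinearOrder M]

theorem sigma_le_iff {x y : Σ _ : ι, L} : x ≤ y ↔ x.1 = y.1 ∧ x.2 ≤ y.2 := by
  obtain ⟨i, a⟩ := x
  obtain ⟨j, b⟩ := y
  rw [Sigma.le_def]
  constructor
  · rintro ⟨h1, h2⟩
    simp only at h1
    subst h1
    exact ⟨rfl, h2⟩
  · rintro ⟨h1, h2⟩
    simp only at h1 h2
    subst h1
    exact ⟨rfl, h2⟩

/-- The embedding of disjoint sums induced by an injection of index sets and embeddings of the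
summands. -/
def sigmaMapEmbedding (φ : ι → κ) (hφ : Function.Injective φ) (g : ι → L ↪o M) :
    (Σ _ : ι, L) ↪o Σ _ : κ, M :=
  OrderEmbedding.ofMapLEIff (fun x => ⟨φ x.1, g x.1 x.2⟩) fun x y => by
    obtain ⟨i, a⟩ := x
    obtain ⟨j, b⟩ := y
    simp only [sigma_le_iff, hφ.eq_iff]
    constructor
    · rintro ⟨rfl, h⟩
      exact ⟨rfl, by simpa using h⟩
    · rintro ⟨rfl, h⟩
      exact ⟨rfl, by simpa using h⟩

@[simp]
theorem sigmaMapEmbedding_apply (φ : ι → κ) (hφ : Function.Injective φ) (g : ι → L ↪o M)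
    (x : Σ _ : ι, L) : sigmaMapEmbedding φ hφ g x = ⟨φ x.1, g x.1 x.2⟩ := rfl

/-- Isomorphic index sets and summands give isomorphic disjoint sums. -/
def sigmaOrderCongr (e : ι ≃ κ) (g : L ≃o M) : (Σ _ : ι, L) ≃o Σ _ : κ, M where
  toFun x := ⟨e x.1, g x.2⟩
  invFun x := ⟨e.symm x.1, g.symm x.2⟩
  left_inv x := by simp
  right_inv x := by simp
  map_rel_iff' := (sigmaMapEmbedding e e.injective fun _ => g.toOrderEmbedding).le_iff_le

/-- An embedding between disjoint sums of chains acts injectively on the summands. -/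
theorem exists_component_map [Nonempty L] (f : (Σ _ : ι, L) ↪o Σ _ : κ, M) :
    ∃ c : ι → κ, Function.Injective c ∧ ∀ i l, (f ⟨i, l⟩).1 = c i := by
  obtain ⟨l₀⟩ := ‹Nonempty L›
  have h : ∀ i l l', (f ⟨i, l⟩).1 = (f ⟨i, l'⟩).1 := by
    intro i l l'
    wlog hl : l ≤ l' generalizing l l'
    · exact (this l' l (le_of_not_ge hl)).symm
    have : f ⟨i, l⟩ ≤ f ⟨i, l'⟩ := f.le_iff_le.2 (sigma_le_iff.2 ⟨rfl, hl⟩)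
    exact (sigma_le_iff.1 this).1
  refine ⟨fun i => (f ⟨i, l₀⟩).1, fun i j hij => ?_, fun i l => h i l l₀⟩
  rcases le_total (f ⟨i, l₀⟩).2 (f ⟨j, l₀⟩).2 with h' | h'
  · exact (sigma_le_iff.1 (f.le_iff_le.1 (sigma_le_iff.2 ⟨hij, h'⟩))).1
  · exact (sigma_le_iff.1 (f.le_iff_le.1 (sigma_le_iff.2 ⟨hij.symm, h'⟩))).1.symm

/-- The embedding of a summand determined by an embedding of disjoint sums. -/
def componentEmbedding (f : (Σ _ : ι, L) ↪o Σ _ : κ, M) (i : ι) {k : κ}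
    (h : ∀ l, (f ⟨i, l⟩).1 = k) : L ↪o M :=
  OrderEmbedding.ofMapLEIff (fun l => (f ⟨i, l⟩).2) fun l l' => by
    have h1 : f ⟨i, l⟩ ≤ f ⟨i, l'⟩ ↔ l ≤ l' := by simp
    rw [← h1, sigma_le_iff, h, h]
    simp

theorem apply_eq_componentEmbedding (f : (Σ _ : ι, L) ↪o Σ _ : κ, M) (i : ι) {k : κ}
    (h : ∀ l, (f ⟨i, l⟩).1 = k) (l : L) : f ⟨i, l⟩ = ⟨k, componentEmbedding f i h l⟩ :=
  Sigma.ext (h l) (heq_of_eq rfl)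

/-- The `k`-th component of `S` contains a copy of `L`. -/
def IsLargeAt (S : Set (Σ _ : ι, L)) (k : ι) : Prop := ∃ g : L ↪o L, ∀ l, ⟨k, g l⟩ ∈ S

/-- Distinct summands go to distinct summands. With the converse below, a subset of a sum over `ℕ`
contains a copy exactly when it is large at infinitely many components. -/
theorem infinite_isLargeAt [Nonempty L] [Infinite ι] {S : Set (Σ _ : ι, L)}
    (f : (Σ _ : ι, L) ↪o Σ _ : ι, L) (hf : ∀ x, f x ∈ S) : {k | IsLargeAt S k}.Infinite := by
  obtain ⟨c, hc, hfc⟩ := exists_component_map f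
  refine Set.infinite_of_injective_forall_mem hc fun i => ⟨componentEmbedding f i (hfc i), ?_⟩
  intro l
  rw [← apply_eq_componentEmbedding]
  exact hf _

theorem exists_embedding_of_infinite_isLargeAt {S : Set (Σ _ : ℕ, L)}
    (h : {k | IsLargeAt S k}.Infinite) : ∃ f : (Σ _ : ℕ, L) ↪o Σ _ : ℕ, L, ∀ x, f x ∈ S := by
  have hφ := fun n => Nat.nth_mem_of_infinite h n
  choose g hg using hφ
  exact ⟨sigmaMapEmbedding _ (Nat.nth_injective h) g, fun x => hg _ _⟩

/-- A disjoint sum of infinitely many copies of a chain has no countably infinite maximal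
antichain of copies. -/
theorem not_hasCountableMaximalAntichain_sigma [Nonempty L] :
    ¬ HasCountableMaximalAntichain (Σ _ : ℕ, L) := by
  rintro ⟨A, hA, hmax⟩
  have h1 : ∀ n, {k | IsLargeAt (A n).1 k}.Infinite := by
    intro n
    obtain ⟨f, hf⟩ := (A n).2
    exact infinite_isLargeAt f fun x => hf ▸ ⟨x, rfl⟩
  have h2 : ∀ i n, i ≠ n → {k | IsLargeAt ((A i).1 ∩ (A n).1) k}.Finite := by
    intro i n hin
    by_contra hinf
    obtain ⟨f, hf⟩ := exists_embedding_of_infinite_isLargeAt hinf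
    exact hA i n hin (compatible_copies_iff.2 ⟨f, hf⟩)
  have h3 : ∀ n, ∃ᶠ k in Filter.atTop,
      IsLargeAt (A n).1 k ∧ ∀ i < n, ¬ IsLargeAt ((A i).1 ∩ (A n).1) k := by
    intro n
    rw [Nat.frequently_atTop_iff_infinite]
    have hfin : (⋃ i ∈ Finset.range n, {k | IsLargeAt ((A i).1 ∩ (A n).1) k}).Finite :=
      Set.Finite.biUnion (Finset.finite_toSet _)
        fun i hi => h2 i n (by have := Finset.mem_range.1 hi; omega)
    refine ((h1 n).sdiff hfin).mono fun k hk => ⟨hk.1, fun i hi hl => hk.2 ?_⟩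
    simp only [Set.mem_iUnion]
    exact ⟨i, Finset.mem_range.2 hi, hl⟩
  -- Diagonalization: at component `φ n` take a chain from `A n` that meets no earlier `A i` in a
  -- large set. The resulting copy is incompatible with every `A i`.
  obtain ⟨φ, hφ, hP⟩ := Filter.extraction_forall_of_frequently h3
  choose g hg using fun n => (hP n).1
  obtain ⟨i, hi⟩ := hmax ⟨_, range_mem_copies (sigmaMapEmbedding φ hφ.injective g)⟩
  obtain ⟨f, hf⟩ := compatible_copies_iff.1 hi
  have hinf := infinite_isLargeAt (S := Set.range _ ∩ (A i).1) f hf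
  -- A large component beyond `φ i` must be some `φ n` with `i < n`, where `A i ∩ A n` was made not
  -- large.
  obtain ⟨k, ⟨g', hg'⟩, hk⟩ := hinf.exists_gt (φ i)
  have hmem : ∀ l, ∃ n, φ n = k ∧ ⟨k, g' l⟩ ∈ (A n).1 := by
    intro l
    obtain ⟨⟨n, a⟩, hx⟩ := (hg' l).1
    simp only [sigmaMapEmbedding_apply, Sigma.mk.injEq, heq_eq_eq] at hx
    refine ⟨n, hx.1, ?_⟩
    rw [← hx.1, ← hx.2]
    exact hg n a
  obtain ⟨l₀⟩ := ‹Nonempty L›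
  obtain ⟨n, rfl, -⟩ := hmem l₀
  refine (hP n).2 i (hφ.lt_iff_lt.1 hk) ⟨g', fun l => ⟨(hg' l).2, ?_⟩⟩
  obtain ⟨n', hn', h⟩ := hmem l
  rwa [hφ.injective hn'] at h

/-- The infinite antichain as a disjoint sum of one-point chains. -/
def sigmaUnitOrderIso : (Σ _ : ℕ, Unit) ≃o AOmega where
  toFun x := (x.1 : ℕ)
  invFun n := ⟨(n : ℕ), ()⟩
  left_inv _ := rfl
  right_inv _ := rfl
  map_rel_iff' {x y} := by
    rw [sigma_le_iff]
    exact ⟨fun h => ⟨h, le_rfl⟩, fun h => h.1⟩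

theorem not_hasCountableMaximalAntichain_AOmega : ¬ HasCountableMaximalAntichain AOmega :=
  fun h => not_hasCountableMaximalAntichain_sigma (h.congr sigmaUnitOrderIso.symm)

theorem HasCountableMaximalAntichain.of_family {X : Type u} [PartialOrder X] {ι : Type*}
    [Denumerable ι] (C : ι → copies X) (hC : ∀ i j, i ≠ j → ¬ Compatible (C i) (C j))
    (hmax : ∀ Z, ∃ i, Compatible Z (C i)) : HasCountableMaximalAntichain X := by
  refine ⟨fun n => C ((Denumerable.eqv ι).symm n), fun i j hij => hC _ _ (by simpa using hij),
    fun Z => ?_⟩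
  obtain ⟨i, hi⟩ := hmax Z
  exact ⟨Denumerable.eqv ι i, by simpa using hi⟩

/-- Every open interval of the rationals is the range of an embedding. -/
theorem exists_rat_embedding_Ioo {a b : ℚ} (hab : a < b) :
    ∃ k : ℚ ↪o ℚ, Set.range k = Set.Ioo a b := by
  have : Nonempty (Set.Ioo a b) := Set.nonempty_Ioo_subtype hab
  obtain ⟨k⟩ := Order.iso_of_countable_dense ℚ (Set.Ioo a b)
  refine ⟨k.toOrderEmbedding.trans (OrderEmbedding.subtype _), ?_⟩
  ext x
  constructor
  · rintro ⟨y, rfl⟩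
    exact (k y).2
  · intro hx
    exact ⟨k.symm ⟨x, hx⟩, by simp⟩

open scoped Classical in
theorem hasCountableMaximalAntichain_sigma_rat [Finite ι] [Nonempty ι] :
    HasCountableMaximalAntichain (Σ _ : ι, ℚ) := by
  obtain ⟨i₀⟩ := ‹Nonempty ι›
  let e : ℤ ↪o ℚ := OrderEmbedding.ofMapLEIff (fun n : ℤ => (n : ℚ)) (by simp)
  have he' : ∀ n, e n = (n : ℚ) := fun n => rfl
  have he : IsCofinalChain e :=
    ⟨fun x => ⟨⌈x⌉, Int.le_ceil x⟩, fun x => ⟨⌊x⌋, Int.floor_le x⟩⟩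
  have hstep : ∀ m : ℤ, e (m - 1) < e m := fun m => e.lt_iff_lt.2 (by omega)
  have hlayer : ∀ m, layer e m = Set.Ioo (e (m - 1)) (e m) := by
    intro m
    ext x
    simp [layer, and_comm]
  -- Only the summand `i₀` is cut, to the open interval from `m - 1` to `m`; the others stay whole.
  let Y : ℤ → Set (Σ _ : ι, ℚ) := fun m => {x | x.1 = i₀ → x.2 ∈ layer e m}
  have hY : ∀ m, Y m ∈ copies (Σ _ : ι, ℚ) := by
    intro m
    obtain ⟨k, hk⟩ := exists_rat_embedding_Ioo (hstep m)
    rw [← hlayer] at hk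
    refine ⟨sigmaMapEmbedding id Function.injective_id
      fun i => if i = i₀ then k else RelEmbedding.refl _, ?_⟩
    ext ⟨i, q⟩
    constructor
    · rintro ⟨⟨j, r⟩, h⟩
      simp only [sigmaMapEmbedding_apply, Sigma.mk.injEq, heq_eq_eq, id] at h
      obtain ⟨rfl, rfl⟩ := h
      intro hi
      simp only at hi
      subst hi
      simp [← hk]
    · intro h
      by_cases hi : i = i₀
      · subst hi
        obtain ⟨r, rfl⟩ := hk.symm ▸ h rfl
        exact ⟨⟨i, r⟩, by simp⟩
      · exact ⟨⟨i, q⟩, by simp [hi]⟩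
  refine HasCountableMaximalAntichain.of_family (fun m => ⟨Y m, hY m⟩) ?_ ?_
  · intro m n hmn hcomp
    obtain ⟨f, hf⟩ := compatible_copies_iff.1 hcomp
    obtain ⟨c, hc, hfc⟩ := exists_component_map f
    -- Finiteness of the index set forces every copy to use the summand `i₀`.
    obtain ⟨i, hi⟩ := Finite.injective_iff_surjective.1 hc i₀
    have hi' := (hfc i 0).trans hi
    exact Set.disjoint_left.1 (disjoint_layer e hmn) ((hf ⟨i, 0⟩).1 hi') ((hf ⟨i, 0⟩).2 hi')
  · rintro ⟨_, f, rfl⟩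
    obtain ⟨c, hc, hfc⟩ := exists_component_map f
    obtain ⟨i, hi⟩ := Finite.injective_iff_surjective.1 hc i₀
    let f' := componentEmbedding f i (hfc i)
    obtain ⟨m, x, y, -, hxy, -, hx, hy, -⟩ :=
      he.exists_chain_mem_layer f' (zero_lt_one (α := ℚ))
    obtain ⟨k, hk⟩ := exists_rat_embedding_Ioo hxy
    refine ⟨m, compatible_copies_iff.2 ⟨(sigmaMapEmbedding id Function.injective_id
      fun j => if j = i then k else RelEmbedding.refl _).trans f, fun z => ⟨⟨_, rfl⟩, ?_⟩⟩⟩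
    obtain ⟨j, q⟩ := z
    intro h
    have hj : j = i := hc (by rw [hi, ← hfc j, ← h]; rfl)
    subst hj
    have hq : k q ∈ Set.Ioo x y := hk ▸ ⟨q, rfl⟩
    have h1 : f' x < f' (k q) := f'.lt_iff_lt.2 hq.1
    have h2 : f' (k q) < f' y := f'.lt_iff_lt.2 hq.2
    have h3 : ((sigmaMapEmbedding id Function.injective_id
      fun l => if l = j then k else RelEmbedding.refl _).trans f ⟨j, q⟩).2 = f' (k q) := by
      simp [f', componentEmbedding]
    rw [h3]
    exact ⟨h2.trans hy.1, fun h' => hx.2 (h1.le.trans h')⟩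

end Sigma

/-! ### Identifying sums of chains; the criterion for a countable antichain -/

section Classification

variable {X : Type u} [PartialOrder X]

/-- The comparability relation of a disjoint sum of chains. -/
def IsChainSum.setoid (hX : IsChainSum X) : Setoid X where
  r a b := a ≤ b ∨ b ≤ a
  iseqv :=
    { refl := fun a => Or.inl le_rfl
      symm := Or.symm
      trans := by
        rintro a b c (h1 | h1) (h2 | h2)
        · exact Or.inl (h1.trans h2)
        · exact hX.1 _ _ _ h1 h2
        · exact hX.2 _ _ _ h1 h2
        · exact Or.inr (h2.trans h1) }

open scoped Classical in
-- Each comparability class is a countable dense chain without endpoints, hence a copy of `ℚ` by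
-- Cantor's theorem.
theorem IsUltrahomogeneous.exists_orderIso_sigma_rat [Countable X] (h : IsUltrahomogeneous X)
    (hlt : ∃ a b : X, a < b) (hX : IsChainSum X) :
    Nonempty (X ≃o Σ _ : Quotient hX.setoid, ℚ) := by
  have := h.noMaxOrder hlt
  have := h.noMinOrder hlt
  have := h.denselyOrdered
  let π : X → Quotient hX.setoid := Quotient.mk _
  have hπ : ∀ {a b}, π a = π b ↔ a ≤ b ∨ b ≤ a := fun {a b} => Quotient.eq
  have hfib : ∀ q, Nonempty ({x // π x = q} ≃o ℚ) := by
    intro q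
    let : LinearOrder {x // π x = q} :=
      { (inferInstance : PartialOrder {x // π x = q}) with
        le_total := fun a b => hπ.1 (a.2.trans b.2.symm)
        toDecidableLE := Classical.decRel _ }
    have : NoMaxOrder {x // π x = q} := ⟨fun a => by
      obtain ⟨b, hb⟩ := exists_gt a.1
      exact ⟨⟨b, (hπ.2 (Or.inr hb.le)).trans a.2⟩, hb⟩⟩
    have : NoMinOrder {x // π x = q} := ⟨fun a => by
      obtain ⟨b, hb⟩ := exists_lt a.1
      exact ⟨⟨b, (hπ.2 (Or.inl hb.le)).trans a.2⟩, hb⟩⟩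
    have : DenselyOrdered {x // π x = q} := ⟨fun a b hab => by
      obtain ⟨c, hac, hcb⟩ := exists_between (show a.1 < b.1 from hab)
      exact ⟨⟨c, (hπ.2 (Or.inr hac.le)).trans a.2⟩, hac, hcb⟩⟩
    have : Nonempty {x // π x = q} := by
      obtain ⟨x, hx⟩ := Quotient.exists_rep q
      exact ⟨x, hx⟩
    exact Order.iso_of_countable_dense _ _
  let e := fun q => (hfib q).some
  have he : ∀ q (x : X) (hx : π x = q), (⟨π x, e (π x) ⟨x, rfl⟩⟩ : Σ _ : Quotient hX.setoid, ℚ) =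
      ⟨q, e q ⟨x, hx⟩⟩ := by
    rintro _ x rfl
    rfl
  refine ⟨⟨⟨fun x => ⟨π x, e (π x) ⟨x, rfl⟩⟩, fun y => ((e y.1).symm y.2).1, fun x => ?_,
    fun y => ?_⟩, ?_⟩⟩
  · simp
  · obtain ⟨q, r⟩ := y
    simp only
    rw [he q _ ((e q).symm r).2]
    simp
  · intro x y
    rw [sigma_le_iff]
    simp only [Equiv.coe_fn_mk]
    constructor
    · rintro ⟨h1, h2⟩
      have h3 := he (π y) x h1
      simp only [Sigma.mk.injEq, heq_eq_eq] at h3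
      rw [h3.2] at h2
      simpa using h2
    · intro hxy
      have h1 : π x = π y := hπ.2 (Or.inl hxy)
      have h3 := he (π y) x h1
      simp only [Sigma.mk.injEq, heq_eq_eq] at h3
      refine ⟨h1, ?_⟩
      rw [h3.2]
      simpa using hxy

/-- A countably infinite order without comparabilities is the countably infinite antichain. -/
theorem exists_orderIso_AOmega [Countable X] [Infinite X] (hlt : ¬ ∃ a b : X, a < b) :
    Nonempty (X ≃o AOmega) := by
  obtain ⟨e⟩ := nonempty_denumerable X
  refine ⟨⟨Denumerable.eqv X, fun {a b} => ?_⟩⟩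
  change Denumerable.eqv X a = Denumerable.eqv X b ↔ a ≤ b
  rw [(Denumerable.eqv X).apply_eq_iff_eq]
  refine ⟨fun h => h.le, fun h => ?_⟩
  by_contra hne
  exact hlt ⟨a, b, lt_of_le_of_ne h hne⟩

theorem IsUltrahomogeneous.hasCountableMaximalAntichain_iff [Countable X] [Infinite X]
    (h : IsUltrahomogeneous X) : HasCountableMaximalAntichain X ↔
      ¬ Nonempty (X ≃o AOmega) ∧ ¬ Nonempty (X ≃o BOmega) := by
  constructor
  · refine fun hX => ⟨?_, ?_⟩
    · rintro ⟨e⟩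
      exact not_hasCountableMaximalAntichain_AOmega (hX.congr e)
    · rintro ⟨e⟩
      exact not_hasCountableMaximalAntichain_sigma (hX.congr e)
  · rintro ⟨hA, hB⟩
    by_cases hlt : ∃ a b : X, a < b
    · rcases h.isBidirected_or_isChainSum with hd | hc
      · exact h.hasCountableMaximalAntichain_of_isBidirected hlt hd
      · obtain ⟨e⟩ := h.exists_orderIso_sigma_rat hlt hc
        have : Nonempty (Quotient hc.setoid) := (Infinite.nonempty X).map (Quotient.mk _)
        rcases finite_or_infinite (Quotient hc.setoid) with hfin | hinf
        · exact hasCountableMaximalAntichain_sigma_rat.congr e.symm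
        · obtain ⟨d⟩ := nonempty_denumerable (Quotient hc.setoid)
          exact absurd ⟨e.trans (sigmaOrderCongr (Denumerable.eqv _) (OrderIso.refl _))⟩ hB
    · exact absurd (exists_orderIso_AOmega hlt) hA

end Classification

/-! ### Almost disjoint families meeting prescribed sets -/

section AlmostDisjoint

/-- Countably many infinite sets have an injective choice function. -/
theorem exists_injective_forall_mem_nat {X : Type*} (T : ℕ → Set X) (hT : ∀ i, (T i).Infinite) :
    ∃ x : ℕ → X, Function.Injective x ∧ ∀ i, x i ∈ T i := by
  have hne : ∀ n (prev : ∀ m, m < n → X),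
      (T n \ Set.range fun m : Fin n => prev m m.2).Nonempty := fun n prev =>
    ((hT n).sdiff (Set.finite_range _)).nonempty
  let F : ∀ n, (∀ m, m < n → X) → X := fun n prev => (hne n prev).some
  let x : ℕ → X := wellFounded_lt.fix F
  have hx : ∀ n, x n ∈ T n \ Set.range fun m : Fin n => x m := by
    intro n
    have h1 : x n = F n fun m _ => x m := wellFounded_lt.fix_eq F n
    rw [h1]
    exact (hne n fun m _ => x m).some_mem
  refine ⟨x, ?_, fun i => (hx i).1⟩
  intro i j hij
  by_contra hne
  rcases lt_or_gt_of_ne hne with h | h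
  · exact (hx j).2 ⟨⟨i, h⟩, hij⟩
  · exact (hx i).2 ⟨⟨j, h⟩, hij.symm⟩

theorem exists_injective_forall_mem {X ι : Type*} [Countable ι] [Infinite X] (T : ι → Set X)
    (hT : ∀ i, (T i).Infinite) : ∃ x : ι → X, Function.Injective x ∧ ∀ i, x i ∈ T i := by
  cases nonempty_encodable ι
  let T' : ℕ → Set X := fun n => (Encodable.decode (α := ι) n).elim Set.univ T
  obtain ⟨x, hx, hxT⟩ := exists_injective_forall_mem_nat T' fun n => by
    show ((Encodable.decode (α := ι) n).elim Set.univ T).Infinite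
    cases Encodable.decode (α := ι) n with
    | none => exact Set.infinite_univ
    | some i => exact hT i
  refine ⟨fun i => x (Encodable.encode i), hx.comp Encodable.encode_injective, fun i => ?_⟩
  simpa [T'] using hxT (Encodable.encode i)

open scoped Classical in
/-- A family of continuum many almost disjoint sets, each meeting all of countably many given
infinite sets. -/
theorem exists_almostDisjoint {X κ : Type*} [Countable κ] [Infinite X] (T : κ → Set X)
    (hT : ∀ i, (T i).Infinite) : ∃ S : Set ℕ → Set X,
      (∀ r k, (S r ∩ T k).Nonempty) ∧ ∀ r r', r ≠ r' → (S r ∩ S r').Finite := by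
  cases nonempty_encodable κ
  obtain ⟨x, hx, hxT⟩ := exists_injective_forall_mem (ι := κ × Finset ℕ) (fun i => T i.1)
    fun i => hT i.1
  -- The point chosen in `T k` for `r` depends only on `r` truncated below the code of `k`. If `r`
  -- and `r'` differ at `i`, their truncations differ once the code exceeds `i`, and injectivity of
  -- `x` leaves finitely many common points.
  let R : Set ℕ → κ → Finset ℕ := fun r k =>
    (Finset.range (Encodable.encode k)).filter fun n => n ∈ r
  refine ⟨fun r => Set.range fun k => x (k, R r k), fun r k => ⟨x (k, R r k), ⟨k, rfl⟩, hxT (k, R r k)⟩, ?_⟩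
  intro r r' hne
  obtain ⟨i, hi⟩ : ∃ i, ¬ (i ∈ r ↔ i ∈ r') := by
    by_contra! h
    exact hne (Set.ext h)
  have hfin : {k : κ | Encodable.encode k ≤ i}.Finite :=
    (Set.finite_Iic i).preimage Encodable.encode_injective.injOn
  refine (hfin.image fun k => x (k, R r k)).subset ?_
  rintro _ ⟨⟨k, rfl⟩, ⟨k', hk'⟩⟩
  refine ⟨k, ?_, rfl⟩
  have h1 := hx hk'
  simp only [Prod.mk.injEq] at h1
  obtain ⟨rfl, h2⟩ := h1
  by_contra hk
  have hlt : i < Encodable.encode k' := not_le.1 hk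
  apply hi
  have := congrArg (fun s => i ∈ s) h2
  simpa [R, hlt] using this.symm

end AlmostDisjoint

/-! ### Maximal antichains of cardinality continuum -/

section Continuum

variable {X : Type u} [PartialOrder X]

variable (X) in
/-- Every type over a finite set that is realized outside the set is realized infinitely often. -/
def HasInfiniteTypes : Prop :=
  ∀ (F : Finset X) (y : X), y ∉ F → (typeSet F y).Infinite

open scoped Classical in
theorem IsUltrahomogeneous.exists_maximal_continuum_of_hasInfiniteTypes [Countable X] [Infinite X]
    (h : IsUltrahomogeneous X) (hX : HasInfiniteTypes X) :
    ∃ 𝒜 : Set (copies X), IsMaximalForcingAntichain 𝒜 ∧ Cardinal.mk 𝒜 = Cardinal.continuum := by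
  obtain ⟨S, hS1, hS2⟩ := exists_almostDisjoint (κ := {p : Finset X × X // p.2 ∉ p.1})
    (fun p => typeSet p.1.1 p.1.2) fun p => hX _ _ p.2
  have hforth : ∀ r, ForthProperty X (S r) := by
    intro r s hs a
    have ht : IsFinPartialIso (s.image fun p => (p.1, p.2.1)) :=
      hs.image (RelEmbedding.refl _) (OrderEmbedding.subtype _)
    obtain ⟨g, hg⟩ := h.exists_extension_matches ht
    have hg' : ∀ p ∈ s, g p.1 = p.2.1 := fun p hp =>
      hg (p.1, p.2.1) (Finset.mem_image.2 ⟨p, hp, rfl⟩)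
    -- If `g a` is already a value of `s`, its type over these values has only one realization, so
    -- that value must be reused.
    by_cases ha : g a ∈ s.image fun p => p.2.1
    · obtain ⟨p, hp, hpa⟩ := Finset.mem_image.1 ha
      have : p.1 = a := g.injective ((hg' p hp).trans hpa)
      subst this
      exact ⟨p.2, fun q hq => ⟨hs q hq p hp, hs p hp q hq⟩⟩
    · obtain ⟨z, hzS, hz⟩ := hS1 r ⟨(s.image fun p => p.2.1, g a), ha⟩
      refine ⟨⟨z, hzS⟩, fun p hp => ?_⟩
      have := hz p.2.1 (Finset.mem_image.2 ⟨p, hp, rfl⟩)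
      simp only [← Subtype.coe_le_coe]
      rw [this.1, this.2, ← hg' p hp]
      simp
  let C := fun r => (hforth r).exists_embedding.some
  let f : ∀ r, X ↪o X := fun r => C r |>.trans (OrderEmbedding.subtype _)
  refine exists_maximal_continuum Cardinal.mk_set_nat (fun r => ⟨_, range_mem_copies (f r)⟩) ?_
  intro r r' hne hcomp
  obtain ⟨k, hk⟩ := compatible_copies_iff.1 hcomp
  refine Set.infinite_of_injective_forall_mem (s := S r ∩ S r') k.injective (fun x => ?_)
    (hS2 r r' hne)
  obtain ⟨⟨y, hy⟩, ⟨z, hz⟩⟩ := hk x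
  exact ⟨hy ▸ (C r y).2, hz ▸ (C r' z).2⟩

open scoped Classical in
-- A point outside `F` can be moved slightly up without changing its type over `F`, so the type has
-- no maximal element and cannot be finite.
theorem hasInfiniteTypes_of_exists_gt [NoMaxOrder X] [DenselyOrdered X]
    (H : ∀ y i : X, ¬ y ≤ i → ¬ i ≤ y → ∃ w, y < w ∧ ¬ i ≤ w)
    (hdir : ∀ y u v : X, y < u → y < v → ∃ w, y < w ∧ w ≤ u ∧ w ≤ v) : HasInfiniteTypes X := by
  have hdir' : ∀ (y : X) (U : Finset X), (∀ u ∈ U, y < u) → ∃ w, y < w ∧ ∀ u ∈ U, w ≤ u := by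
    intro y U
    induction U using Finset.induction_on with
    | empty => exact fun _ => (exists_gt y).imp fun w hw => ⟨hw, by simp⟩
    | insert a U _ ih =>
      intro hU
      obtain ⟨w, hw, hwU⟩ := ih fun u hu => hU u (Finset.mem_insert_of_mem hu)
      obtain ⟨v, hv, hva, hvw⟩ := hdir y a w (hU a (Finset.mem_insert_self _ _)) hw
      exact ⟨v, hv, Finset.forall_mem_insert _ _ _ |>.2 ⟨hva, fun u hu => hvw.trans (hwU u hu)⟩⟩
  have hstep : ∀ (F : Finset X) (y : X), y ∉ F → ∃ w, y < w ∧ w ∈ typeSet F y := by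
    intro F y hy
    -- For `c` in `F`, every point strictly between `y` and `u` relates to `c` as `y` does.
    have hc : ∀ c : X, ∃ u, y < u ∧ (c ∈ F → y ≤ c → u = c) ∧ (¬ y ≤ c → ¬ c ≤ y → ¬ c ≤ u) := by
      intro c
      obtain ⟨v, hv⟩ := exists_gt y
      by_cases h1 : y ≤ c
      · by_cases hcF : c ∈ F
        · exact ⟨c, lt_of_le_of_ne h1 (by rintro rfl; exact hy hcF), fun _ _ => rfl,
            fun h => absurd h1 h⟩
        · exact ⟨v, hv, fun h => absurd h hcF, fun h => absurd h1 h⟩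
      · by_cases h2 : c ≤ y
        · exact ⟨v, hv, fun _ h => absurd h h1, fun _ h => absurd h2 h⟩
        · obtain ⟨w, hw1, hw2⟩ := H y c h1 h2
          exact ⟨w, hw1, fun _ h => absurd h h1, fun _ _ => hw2⟩
    choose u hu1 hu2 hu3 using hc
    obtain ⟨w, hw, hwF⟩ := hdir' y (F.image u) (by simpa using fun c _ => hu1 c)
    obtain ⟨v, hyv, hvw⟩ := exists_between hw
    refine ⟨v, hyv, fun c hc => ?_⟩
    have hvu : v < u c := hvw.trans_le (hwF _ (Finset.mem_image_of_mem _ hc))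
    by_cases h1 : y ≤ c
    · have hvc : v < c := by rwa [hu2 c hc h1] at hvu
      simp [h1, hvc.le, hvc.not_ge, (hyv.trans hvc).not_ge]
    · have h3 : ¬ v ≤ c := fun h => h1 (hyv.le.trans h)
      by_cases h2 : c ≤ y
      · simp [h1, h2, h3, h2.trans hyv.le]
      · have h4 : ¬ c ≤ v := fun h => hu3 c h1 h2 (h.trans hvu.le)
        simp [h1, h2, h3, h4]
  intro F y hy hfin
  obtain ⟨m, hm⟩ := hfin.exists_maximal ⟨y, fun _ _ => ⟨Iff.rfl, Iff.rfl⟩⟩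
  have hmF : m ∉ F := by
    intro hmF
    have h1 := (hm.prop m hmF).1.1 le_rfl
    have h2 := (hm.prop m hmF).2.1 le_rfl
    exact hy (le_antisymm h1 h2 ▸ hmF)
  obtain ⟨w, hmw, hw⟩ := hstep F m hmF
  exact (hm.le_of_ge (fun c hc => ⟨(hw c hc).1.trans (hm.prop c hc).1,
    (hw c hc).2.trans (hm.prop c hc).2⟩) hmw.le).not_gt hmw

theorem hasInfiniteTypes_of_forall_not_lt [Infinite X] (hlt : ¬ ∃ a b : X, a < b) :
    HasInfiniteTypes X := by
  have heq : ∀ {a b : X}, a ≤ b ↔ a = b := fun {a b} =>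
    ⟨fun h => by_contra fun hne => hlt ⟨a, b, lt_of_le_of_ne h hne⟩, fun h => h.le⟩
  intro F y hy
  refine (F.finite_toSet.infinite_compl).mono fun z hz c hc => ?_
  have h1 : z ≠ c := fun h => hz (h ▸ hc)
  have h2 : y ≠ c := fun h => hy (h ▸ hc)
  simp [heq, h1, h2, h1.symm, h2.symm]

/-- For incomparable `u` and `v`, take `a < y` and an automorphism fixing `u` and `v` and raising
`a` to `y`; it carries `y` to the required point. -/
theorem IsUltrahomogeneous.exists_le_le_of_lt_of_lt (h : IsUltrahomogeneous X) [NoMinOrder X]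
    (y u v : X) (hu : y < u) (hv : y < v) : ∃ w, y < w ∧ w ≤ u ∧ w ≤ v := by
  by_cases h1 : u ≤ v
  · exact ⟨u, hu, le_rfl, h1⟩
  by_cases h2 : v ≤ u
  · exact ⟨v, hv, h2, le_rfl⟩
  obtain ⟨a, ha⟩ := exists_lt y
  obtain ⟨g, hg1, hg2, hg3⟩ := h.exists_map_eq_three (x := a) (y := u) (z := v)
    (x' := y) (y' := u) (z' := v) (by simp [hu.le, (ha.trans hu).le])
    (by simp [hu.not_ge, (ha.trans hu).not_ge]) (by simp [hv.le, (ha.trans hv).le])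
    (by simp [hv.not_ge, (ha.trans hv).not_ge]) Iff.rfl Iff.rfl
  refine ⟨g y, ?_, ?_, ?_⟩
  · simpa [hg1] using g.lt_iff_lt.2 ha
  · simpa [hg2] using g.le_iff_le.2 hu.le
  · simpa [hg3] using g.le_iff_le.2 hv.le

open scoped Classical in
/-- If incomparable points have the same points above them, the order has a linear quotient. -/
theorem exists_linear_quotient (hW : ∀ p q : X, ¬ p ≤ q → ¬ q ≤ p → ∀ w, p < w → q < w) :
    ∃ (L : Type u) (_ : LinearOrder L) (ρ : X → L), Function.Surjective ρ ∧
      ∀ a b, a < b ↔ ρ a < ρ b := by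
  -- Larger points have fewer points above them, hence the reversed inclusion; incomparable points
  -- get the same value.
  let σ : X → (Set X)ᵒᵈ := fun a => OrderDual.toDual {w | a < w}
  have hmono : ∀ a b, a ≤ b → σ a ≤ σ b := fun a b hab w (hw : b < w) => hab.trans_lt hw
  have heq : ∀ a b, ¬ a ≤ b → ¬ b ≤ a → σ a = σ b := fun a b h1 h2 =>
    congrArg OrderDual.toDual (Set.ext fun w => ⟨hW a b h1 h2 w, hW b a h2 h1 w⟩)
  have htot : ∀ a b, σ a ≤ σ b ∨ σ b ≤ σ a := by
    intro a b
    by_cases h1 : a ≤ b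
    · exact Or.inl (hmono _ _ h1)
    by_cases h2 : b ≤ a
    · exact Or.inr (hmono _ _ h2)
    · exact Or.inl (heq a b h1 h2).le
  let inst : LinearOrder (Set.range σ) :=
    { (inferInstance : PartialOrder (Set.range σ)) with
      le_total := by
        rintro ⟨_, a, rfl⟩ ⟨_, b, rfl⟩
        exact htot a b
      toDecidableLE := Classical.decRel _ }
  refine ⟨Set.range σ, inst, fun a => ⟨σ a, a, rfl⟩, ?_, fun a b => ?_⟩
  · rintro ⟨_, a, rfl⟩
    exact ⟨a, rfl⟩
  · show a < b ↔ σ a < σ b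
    constructor
    · refine fun hab => lt_of_le_of_ne (hmono _ _ hab.le) fun h => ?_
      have : b ∈ {w | a < w} := hab
      rw [show {w | a < w} = {w | b < w} from congrArg OrderDual.ofDual h] at this
      exact lt_irrefl b this
    · intro hab
      have h1 : ¬ b ≤ a := fun h => (hmono _ _ h).not_gt hab
      by_cases h2 : a ≤ b
      · exact lt_of_le_not_ge h2 h1
      · exact absurd (heq a b h2 h1) hab.ne

theorem IsUltrahomogeneous.exists_maximal_continuum_of_linear_quotient [Countable X]
    (h : IsUltrahomogeneous X) (hlt : ∃ a b : X, a < b) {L : Type u} [LinearOrder L] (ρ : X → L)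
    (hρ : Function.Surjective ρ) (hρlt : ∀ a b, a < b ↔ ρ a < ρ b) :
    ∃ 𝒜 : Set (copies X), IsMaximalForcingAntichain 𝒜 ∧ Cardinal.mk 𝒜 = Cardinal.continuum := by
  have := h.noMaxOrder hlt
  have := h.noMinOrder hlt
  have := h.denselyOrdered
  have : Countable L := hρ.countable
  have : NoMaxOrder L := ⟨fun l => by
    obtain ⟨a, rfl⟩ := hρ l
    obtain ⟨b, hb⟩ := exists_gt a
    exact ⟨ρ b, (hρlt _ _).1 hb⟩⟩
  have : NoMinOrder L := ⟨fun l => by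
    obtain ⟨a, rfl⟩ := hρ l
    obtain ⟨b, hb⟩ := exists_lt a
    exact ⟨ρ b, (hρlt _ _).1 hb⟩⟩
  have : DenselyOrdered L := ⟨fun l m hlm => by
    obtain ⟨a, rfl⟩ := hρ l
    obtain ⟨b, rfl⟩ := hρ m
    obtain ⟨c, hc1, hc2⟩ := exists_between ((hρlt _ _).2 hlm)
    exact ⟨ρ c, (hρlt _ _).1 hc1, (hρlt _ _).1 hc2⟩⟩
  have : Nonempty L := ⟨ρ hlt.choose⟩
  have : Infinite L := NoMaxOrder.infinite
  -- Meeting every open interval makes each `S r` dense in `L`, hence isomorphic to `L`.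
  obtain ⟨S, hS1, hS2⟩ := exists_almostDisjoint (κ := {p : L × L // p.1 < p.2})
    (fun p => Set.Ioo p.1.1 p.1.2) fun p => Set.Ioo_infinite p.2
  have hdense : ∀ r {l m : L}, l < m → ∃ z : S r, l < z ∧ (z : L) < m := fun r l m hlm => by
    obtain ⟨z, hz, h1, h2⟩ := hS1 r ⟨(l, m), hlm⟩
    exact ⟨⟨z, hz⟩, h1, h2⟩
  have hiso : ∀ r, Nonempty (L ≃o S r) := by
    intro r
    have : NoMaxOrder (S r) := ⟨fun l => by
      obtain ⟨m, hm⟩ := exists_gt l.1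
      obtain ⟨z, hz, -⟩ := hdense r hm
      exact ⟨z, hz⟩⟩
    have : NoMinOrder (S r) := ⟨fun l => by
      obtain ⟨m, hm⟩ := exists_lt l.1
      obtain ⟨z, -, hz⟩ := hdense r hm
      exact ⟨z, hz⟩⟩
    have : DenselyOrdered (S r) := ⟨fun l m hlm => by
      obtain ⟨z, hz⟩ := hdense r (show l.1 < m.1 from hlm)
      exact ⟨z, hz⟩⟩
    have : Nonempty (S r) := by
      obtain ⟨l⟩ := ‹Nonempty L›
      obtain ⟨m, hm⟩ := exists_gt l
      exact ⟨(hdense r hm).choose⟩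
    exact Order.iso_of_countable_dense _ _
  have hρeq : ∀ (g : X ≃o X) {a b}, ρ a = ρ b → ρ (g a) = ρ (g b) := by
    intro g a b hab
    refine le_antisymm (not_lt.1 fun h' => ?_) (not_lt.1 fun h' => ?_)
    · have := g.lt_iff_lt.1 ((hρlt _ _).2 h')
      exact ((hρlt _ _).1 this).ne hab.symm
    · have := g.lt_iff_lt.1 ((hρlt _ _).2 h')
      exact ((hρlt _ _).1 this).ne hab
  have hlift : ∀ f : L ↪o L, ∃ F : X ↪o X, ∀ x, ρ (F x) = f (ρ x) := by
    intro f
    choose σ hσ using hρ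
    -- One automorphism moves the whole fibre over `l` into the fibre over `f l`. Within a fibre it
    -- preserves the order, and between fibres `ρ` decides.
    choose g hg using fun l => h.exists_map_eq (σ l) (σ (f l))
    have hF : ∀ x, ρ (g (ρ x) x) = f (ρ x) := fun x => by
      rw [hρeq (g (ρ x)) (hσ (ρ x)).symm, hg, hσ]
    refine ⟨OrderEmbedding.ofMapLEIff (fun x => g (ρ x) x) fun x y => ?_, hF⟩
    have hcase : ∀ x y, ρ x < ρ y → x < y ∧ g (ρ x) x < g (ρ y) y := fun x y hxy =>
      ⟨(hρlt _ _).2 hxy, (hρlt _ _).2 (by rw [hF, hF]; exact f.lt_iff_lt.2 hxy)⟩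
    rcases lt_trichotomy (ρ x) (ρ y) with hxy | hxy | hxy
    · obtain ⟨h1, h2⟩ := hcase x y hxy
      simp [h1.le, h2.le]
    · simp [hxy]
    · obtain ⟨h1, h2⟩ := hcase y x hxy
      simp [h1.not_ge, h2.not_ge]
  let f : ∀ r, L ↪o L := fun r => (hiso r).some.toOrderEmbedding.trans (OrderEmbedding.subtype _)
  have hf : ∀ r l, f r l ∈ S r := fun r l => ((hiso r).some l).2
  choose F hF using fun r => hlift (f r)
  refine exists_maximal_continuum Cardinal.mk_set_nat (fun r => ⟨_, range_mem_copies (F r)⟩) ?_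
  intro r r' hne hcomp
  obtain ⟨k, hk⟩ := compatible_copies_iff.1 hcomp
  choose σ hσ using hρ
  have hmono : StrictMono fun l => ρ (k (σ l)) := fun l m hlm =>
    (hρlt _ _).1 (k.lt_iff_lt.2 ((hρlt _ _).2 (by rwa [hσ, hσ])))
  refine Set.infinite_of_injective_forall_mem (s := S r ∩ S r') hmono.injective (fun l => ?_)
    (hS2 r r' hne)
  obtain ⟨⟨y, hy⟩, ⟨z, hz⟩⟩ := hk (σ l)
  constructor
  · simp only [← hy, hF]
    exact hf _ _
  · simp only [← hz, hF]
    exact hf _ _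

/-- The order of copies of a countably infinite ultrahomogeneous partial order has a maximal
antichain of cardinality continuum. -/
theorem IsUltrahomogeneous.exists_maximal_continuum [Countable X] [Infinite X]
    (h : IsUltrahomogeneous X) :
    ∃ 𝒜 : Set (copies X), IsMaximalForcingAntichain 𝒜 ∧ Cardinal.mk 𝒜 = Cardinal.continuum := by
  by_cases hlt : ∃ a b : X, a < b
  swap
  · exact h.exists_maximal_continuum_of_hasInfiniteTypes (hasInfiniteTypes_of_forall_not_lt hlt)
  have := h.noMaxOrder hlt
  have := h.noMinOrder hlt
  have := h.denselyOrdered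
  by_cases H : ∀ y i : X, ¬ y ≤ i → ¬ i ≤ y → ∃ w, y < w ∧ ¬ i ≤ w
  · exact h.exists_maximal_continuum_of_hasInfiniteTypes
      (hasInfiniteTypes_of_exists_gt H h.exists_le_le_of_lt_of_lt)
  · push Not at H
    obtain ⟨y, i, h1, h2, hyi⟩ := H
    -- Homogeneity spreads the failure at `y`, `i` to every incomparable pair.
    have hW : ∀ p q : X, ¬ p ≤ q → ¬ q ≤ p → ∀ w, p < w → q < w := by
      intro p q hpq hqp w hw
      obtain ⟨g, rfl, rfl⟩ := h.exists_map_eq_two (x := y) (y := i) (x' := p) (y' := q)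
        (by simp [*]) (by simp [*])
      have h3 : y < g.symm w := by rwa [g.lt_symm_apply]
      have h4 := hyi _ h3
      rw [g.le_symm_apply] at h4
      exact lt_of_le_of_ne h4 (by rintro rfl; exact hpq hw.le)
    obtain ⟨L, _, ρ, hρ, hρlt⟩ := exists_linear_quotient hW
    exact h.exists_maximal_continuum_of_linear_quotient hlt ρ hρ hρlt

end Continuum

/-! ### The one-point extension property -/

section Extension

variable {D : Type u} [PartialOrder D]

variable (D) in
/-- The one-point extension property: over every finite set `F` there is a point whose relations
to `F` are exactly those forced by lying above `L` and below `U`. -/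
def HasExtensionProperty : Prop :=
  ∀ L U F : Finset D, (∀ l ∈ L, ∀ u ∈ U, l < u) →
    ∃ z, ∀ d ∈ F, (z ≤ d ↔ ∃ u ∈ U, u ≤ d) ∧ (d ≤ z ↔ ∃ l ∈ L, d ≤ l)

/-- The relation extending the order by one new point `none` between `L` and `U`. -/
def adjoinLE (L U : Finset D) : Option D → Option D → Prop
  | none, none => True
  | none, some d => ∃ u ∈ U, u ≤ d
  | some d, none => ∃ l ∈ L, d ≤ l
  | some d, some d' => d ≤ d'

theorem adjoinLE_refl (L U : Finset D) : ∀ x, adjoinLE L U x x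
  | none => trivial
  | some d => le_refl d

theorem adjoinLE_trans {L U : Finset D} (hLU : ∀ l ∈ L, ∀ u ∈ U, l < u) {x y z : Option D}
    (h1 : adjoinLE L U x y) (h2 : adjoinLE L U y z) : adjoinLE L U x z := by
  rcases x with _ | x <;> rcases y with _ | y <;> rcases z with _ | z
  · trivial
  · exact h2
  · trivial
  · obtain ⟨u, hu, h⟩ := h1
    exact ⟨u, hu, h.trans h2⟩
  · exact h1
  · obtain ⟨l, hl, hxl⟩ := h1
    obtain ⟨u, hu, huz⟩ := h2
    exact hxl.trans ((hLU l hl u hu).le.trans huz)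
  · obtain ⟨l, hl, h⟩ := h2
    exact ⟨l, hl, le_trans h1 h⟩
  · exact le_trans (a := x) h1 h2

theorem adjoinLE_antisymm {L U : Finset D} (hLU : ∀ l ∈ L, ∀ u ∈ U, l < u) {x y : Option D}
    (h1 : adjoinLE L U x y) (h2 : adjoinLE L U y x) : x = y := by
  rcases x with _ | x <;> rcases y with _ | y
  · rfl
  · obtain ⟨u, hu, huy⟩ := h1
    obtain ⟨l, hl, hyl⟩ := h2
    exact absurd (huy.trans hyl) (hLU l hl u hu).not_ge
  · obtain ⟨u, hu, huy⟩ := h2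
    obtain ⟨l, hl, hyl⟩ := h1
    exact absurd (huy.trans hyl) (hLU l hl u hu).not_ge
  · exact congrArg some (le_antisymm (a := x) h1 h2)

/-- Adjoin the desired point abstractly, embed the enlarged order by universality, and bring the
image of `F` back to `F` by homogeneity. `Shrink` meets the universe restriction in universality. -/
theorem IsRandomPoset.hasExtensionProperty (h : IsRandomPoset D) : HasExtensionProperty D := by
  obtain ⟨hcount, hhom, huniv⟩ := h
  intro L U F hLU
  let c := (equivShrink.{0} (Option D))
  let : PartialOrder (Shrink.{0} (Option D)) :=
    { le := fun x y => adjoinLE L U (c.symm x) (c.symm y)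
      le_refl := fun x => adjoinLE_refl L U _
      le_trans := fun x y z h1 h2 => adjoinLE_trans hLU h1 h2
      le_antisymm := fun x y h1 h2 => c.symm.injective (adjoinLE_antisymm hLU h1 h2) }
  have : Countable (Shrink.{0} (Option D)) := c.symm.injective.countable
  obtain ⟨f⟩ := huniv (Shrink.{0} (Option D))
  have hf : ∀ x y, f (c x) ≤ f (c y) ↔ adjoinLE L U x y := fun x y => by
    rw [f.le_iff_le]
    show adjoinLE L U (c.symm (c x)) (c.symm (c y)) ↔ _
    simp
  obtain ⟨g, hg⟩ := hhom.exists_extension (fun d : F => f (c (some d.1))) (fun d => d.1)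
    fun d d' => hf _ _
  refine ⟨g (f (c none)), fun d hd => ?_⟩
  have hgd := hg ⟨d, hd⟩
  simp only at hgd
  constructor
  · conv_lhs => rw [← hgd]
    rw [g.le_iff_le, hf]
    rfl
  · conv_lhs => rw [← hgd]
    rw [g.le_iff_le, hf]
    rfl

open scoped Classical in
theorem HasExtensionProperty.forthProperty {α : Type*} [PartialOrder α]
    (h : HasExtensionProperty D) : ForthProperty α D := by
  intro s hs a
  by_cases ha : ∃ p ∈ s, p.1 = a
  · obtain ⟨p, hp, rfl⟩ := ha
    exact ⟨p.2, fun q hq => ⟨hs q hq p hp, hs p hp q hq⟩⟩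
  obtain ⟨z, hz⟩ := h ((s.filter fun p => p.1 ≤ a).image Prod.snd)
    ((s.filter fun p => a ≤ p.1).image Prod.snd) (s.image Prod.snd) (by
      intro l hl u hu
      simp only [Finset.mem_image, Finset.mem_filter] at hl hu
      obtain ⟨p, ⟨hp, hpa⟩, rfl⟩ := hl
      obtain ⟨q, ⟨hq, haq⟩, rfl⟩ := hu
      refine lt_of_le_not_ge ((hs p hp q hq).1 (hpa.trans haq)) fun h' => ha ⟨p, hp, ?_⟩
      exact le_antisymm hpa (haq.trans ((hs q hq p hp).2 h')))
  refine ⟨z, fun p hp => ?_⟩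
  obtain ⟨h1, h2⟩ := hz p.2 (Finset.mem_image_of_mem _ hp)
  rw [h1, h2]
  constructor
  · constructor
    · exact fun hpa => ⟨p.2, Finset.mem_image_of_mem _ (Finset.mem_filter.2 ⟨hp, hpa⟩), le_rfl⟩
    · rintro ⟨l, hl, hpl⟩
      simp only [Finset.mem_image, Finset.mem_filter] at hl
      obtain ⟨q, ⟨hq, hqa⟩, rfl⟩ := hl
      exact ((hs p hp q hq).2 hpl).trans hqa
  · constructor
    · exact fun hap => ⟨p.2, Finset.mem_image_of_mem _ (Finset.mem_filter.2 ⟨hp, hap⟩), le_rfl⟩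
    · rintro ⟨u, hu, hup⟩
      simp only [Finset.mem_image, Finset.mem_filter] at hu
      obtain ⟨q, ⟨hq, haq⟩, rfl⟩ := hu
      exact haq.trans ((hs q hq p hp).2 hup)

open scoped Classical in
theorem ForthProperty.swap {α β : Type*} [PartialOrder α] [PartialOrder β]
    (h : ForthProperty β α) : BackProperty α β := by
  intro s hs b
  obtain ⟨a, ha⟩ := h (s.image Prod.swap) (by
    intro p hp q hq
    obtain ⟨p, hps, rfl⟩ := Finset.mem_image.1 hp
    obtain ⟨q, hqs, rfl⟩ := Finset.mem_image.1 hq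
    exact (hs p hps q hqs).symm) b
  refine ⟨a, fun p hp => ?_⟩
  have := ha p.swap (Finset.mem_image_of_mem _ hp)
  exact ⟨this.1.symm, this.2.symm⟩

theorem HasExtensionProperty.exists_orderIso {E : Type*} [PartialOrder E] [Countable D]
    [Countable E] (hD : HasExtensionProperty D) (hE : HasExtensionProperty E) :
    Nonempty (D ≃o E) :=
  exists_orderIso_of_forth_back hE.forthProperty hD.forthProperty.swap

open scoped Classical in
theorem hasExtensionProperty_coe {S : Set D}
    (h : ∀ L U F : Finset D, (∀ d ∈ L, d ∈ S) → (∀ d ∈ U, d ∈ S) → (∀ d ∈ F, d ∈ S) →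
      (∀ l ∈ L, ∀ u ∈ U, l < u) →
      ∃ z ∈ S, ∀ d ∈ F, (z ≤ d ↔ ∃ u ∈ U, u ≤ d) ∧ (d ≤ z ↔ ∃ l ∈ L, d ≤ l)) :
    HasExtensionProperty S := by
  intro L U F hLU
  have hS : ∀ G : Finset S, ∀ d ∈ G.image Subtype.val, d ∈ S := by
    intro G d hd
    obtain ⟨x, -, rfl⟩ := Finset.mem_image.1 hd
    exact x.2
  obtain ⟨z, hzS, hz⟩ := h (L.image Subtype.val) (U.image Subtype.val) (F.image Subtype.val)
    (hS L) (hS U) (hS F) (by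
      intro l hl u hu
      obtain ⟨l, hl', rfl⟩ := Finset.mem_image.1 hl
      obtain ⟨u, hu', rfl⟩ := Finset.mem_image.1 hu
      exact hLU l hl' u hu')
  refine ⟨⟨z, hzS⟩, fun d hd => ?_⟩
  have := hz d (Finset.mem_image_of_mem _ hd)
  simpa [← Subtype.coe_le_coe] using this

theorem HasExtensionProperty.nonempty (h : HasExtensionProperty D) : Nonempty D :=
  ⟨(h ∅ ∅ ∅ (by simp)).choose⟩

theorem HasExtensionProperty.exists_gt (h : HasExtensionProperty D) (a : D) : ∃ z, a < z := by
  obtain ⟨z, hz⟩ := h {a} ∅ {a} (by simp)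
  exact ⟨z, lt_of_le_not_ge (by simp [hz]) (by simp [hz])⟩

open scoped Classical in
theorem HasExtensionProperty.isBidirected (h : HasExtensionProperty D) : IsBidirected D := by
  constructor
  · intro a b
    obtain ⟨z, hz⟩ := h {a, b} ∅ {a, b} (by simp)
    exact ⟨z, by simp [hz], by simp [hz]⟩
  · intro a b
    obtain ⟨z, hz⟩ := h ∅ {a, b} {a, b} (by simp)
    exact ⟨z, by simp [hz], by simp [hz]⟩

open scoped Classical in
-- Adding `e m` to the upper constraints puts the new point in the layer, and creates no relation to
-- points of the layer since none lies above `e m`.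
theorem HasExtensionProperty.layer (h : HasExtensionProperty D) (e : ℤ ↪o D) (m : ℤ) :
    HasExtensionProperty (layer e m) := by
  refine hasExtensionProperty_coe fun L U F hL hU hF hLU => ?_
  obtain ⟨z, hz⟩ := h L (insert (e m) U) (insert (e m) (insert (e (m - 1)) F)) (by
    intro l hl u hu
    rcases Finset.mem_insert.1 hu with rfl | hu
    · exact (hL l hl).1
    · exact hLU l hl u hu)
  have h1 := hz (e m) (by simp)
  have h2 := hz (e (m - 1)) (by simp)
  refine ⟨z, ⟨lt_of_le_not_ge (h1.1.2 ⟨e m, by simp⟩) fun h' => ?_, fun h' => ?_⟩, ?_⟩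
  · obtain ⟨l, hl, hml⟩ := h1.2.1 h'
    exact hml.not_gt (hL l hl).1
  · obtain ⟨u, hu, hum⟩ := h2.1.1 h'
    rcases Finset.mem_insert.1 hu with rfl | hu
    · have := e.le_iff_le.1 hum
      omega
    · exact (hU u hu).2 hum
  · intro d hd
    obtain ⟨h3, h4⟩ := hz d (by simp [hd])
    refine ⟨h3.trans ?_, h4⟩
    simp only [Finset.exists_mem_insert]
    exact or_iff_right (hF d hd).1.not_ge

open scoped Classical in
theorem HasExtensionProperty.compl_range (h : HasExtensionProperty D) (e : ℤ ↪o D) :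
    HasExtensionProperty ((Set.range e)ᶜ : Set D) := by
  refine hasExtensionProperty_coe fun L U F hL hU hF hLU => ?_
  -- If this point is some `e k`, it is replaced by one strictly between `e k` and `e (k + 1)` and
  -- below `U`, which has the same relations to `F` and misses the chain.
  obtain ⟨z, hz⟩ := h L U (F ∪ L ∪ U) hLU
  by_cases hze : z ∈ Set.range e
  swap
  · exact ⟨z, hze, fun d hd => hz d (by simp [hd])⟩
  obtain ⟨k, rfl⟩ := hze
  have hkU : ∀ u ∈ U, e k < u := fun u hu =>
    lt_of_le_of_ne ((hz u (by simp [hu])).1.2 ⟨u, hu, le_rfl⟩) fun h' => hU u hu ⟨k, h'⟩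
  have hk : e k < e (k + 1) := e.lt_iff_lt.2 (by omega)
  obtain ⟨w, hw⟩ := h {e k} (insert (e (k + 1)) U) (insert (e k) (insert (e (k + 1)) F)) (by
    intro l hl u hu
    obtain rfl := Finset.mem_singleton.1 hl
    rcases Finset.mem_insert.1 hu with rfl | hu
    · exact hk
    · exact hkU u hu)
  have h1 : e k ≤ w := (hw (e k) (by simp)).2.2 ⟨e k, by simp⟩
  have h2 : w ≤ e (k + 1) := (hw (e (k + 1)) (by simp)).1.2 ⟨e (k + 1), by simp⟩
  have h3 : ¬ w ≤ e k := by
    rw [(hw (e k) (by simp)).1]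
    rintro ⟨u, hu, huk⟩
    rcases Finset.mem_insert.1 hu with rfl | hu
    · exact huk.not_gt hk
    · exact huk.not_gt (hkU u hu)
  have h4 : ¬ e (k + 1) ≤ w := by
    rw [(hw (e (k + 1)) (by simp)).2]
    simp [hk.not_ge]
  refine ⟨w, ?_, fun d hd => ?_⟩
  · rintro ⟨j, rfl⟩
    simp only [e.le_iff_le] at h3 h4
    omega
  · have hd' := hz d (by simp [hd])
    obtain ⟨h5, h6⟩ := hw d (by simp [hd])
    rw [h5, h6]
    constructor
    · simp only [Finset.exists_mem_insert]
      exact or_iff_right_of_imp fun h' => hd'.1.1 (hk.le.trans h')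
    · simpa using hd'.2

end Extension

/-! ### The layers of the random poset -/

section RandomPoset

variable {D : Type u} [PartialOrder D]

theorem IsCofinalChain.iUnion_layer {e : ℤ ↪o D} (he : IsCofinalChain e)
    : ⋃ m, layer e m = (Set.range e)ᶜ := by
  obtain ⟨μ, hμ⟩ := he.exists_least
  ext x
  simp only [Set.mem_iUnion, Set.mem_compl_iff]
  constructor
  · rintro ⟨m, h1, h2⟩ ⟨k, rfl⟩
    rw [e.lt_iff_lt] at h1
    rw [e.le_iff_le] at h2
    omega
  · intro hx
    refine ⟨μ x, lt_of_le_of_ne (hμ x).1 fun h => hx ⟨_, h.symm⟩, fun h => ?_⟩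
    have := (hμ x).2 _ h
    omega

/-- The trace of a layer on the union of all layers. -/
def layerInUnion (e : ℤ ↪o D) (m : ℤ) : Set ↥(⋃ k, layer e k) := Subtype.val ⁻¹' layer e m

/-- The trace of a layer on the union is isomorphic to the layer. -/
def layerInUnionOrderIso (e : ℤ ↪o D) (m : ℤ) : layer e m ≃o layerInUnion e m where
  toFun x := ⟨⟨x.1, Set.mem_iUnion.2 ⟨m, x.2⟩⟩, x.2⟩
  invFun x := ⟨x.1.1, x.2⟩
  left_inv _ := rfl
  right_inv _ := rfl
  map_rel_iff' := Iff.rfl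

theorem image_layerInUnion (e : ℤ ↪o D) (m : ℤ) :
    Subtype.val '' layerInUnion e m = layer e m := by
  rw [layerInUnion, Subtype.image_preimage_coe]
  exact Set.inter_eq_right.2 (Set.subset_iUnion (fun k => layer e k) m)

theorem IsRandomPoset.exists_layers (h : IsRandomPoset D) : ∃ e : ℤ ↪o D,
    ¬ BddAbove (Set.range e) ∧ ¬ BddBelow (Set.range e) ∧
    (∀ m : ℤ, layer e m ∈ copies D) ∧
    (∀ m n : ℤ, m ≠ n → Disjoint (layer e m) (layer e n)) ∧
    (⋃ m : ℤ, layer e m) ∈ copies D ∧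
    ∃ Y : ℤ → copies ↥(⋃ m : ℤ, layer e m),
      (∀ m : ℤ, Subtype.val '' (Y m).val = layer e m) ∧
      IsMaximalForcingAntichain (Set.range Y) := by
  have hext := h.hasExtensionProperty
  obtain ⟨hcount, hhom, -⟩ := h
  obtain ⟨a₀⟩ := hext.nonempty
  obtain ⟨b₀, hab₀⟩ := hext.exists_gt a₀
  have := hhom.noMaxOrder ⟨a₀, b₀, hab₀⟩
  have := hhom.noMinOrder ⟨a₀, b₀, hab₀⟩
  have := hhom.denselyOrdered
  have : Nonempty D := ⟨a₀⟩
  obtain ⟨e, he⟩ := hext.isBidirected.exists_isCofinalChain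
  have hmax : ¬ BddAbove (Set.range e) := by
    rintro ⟨x, hx⟩
    obtain ⟨y, hy⟩ := exists_gt x
    obtain ⟨m, hm⟩ := he.1 y
    exact (hm.trans (hx ⟨m, rfl⟩)).not_gt hy
  have hmin : ¬ BddBelow (Set.range e) := by
    rintro ⟨x, hx⟩
    obtain ⟨y, hy⟩ := exists_lt x
    obtain ⟨m, hm⟩ := he.2 y
    exact ((hx ⟨m, rfl⟩).trans hm).not_gt hy
  have hlayer : ∀ m, Nonempty (D ≃o layer e m) := fun m => hext.exists_orderIso (hext.layer e m)
  have hunion : Nonempty (D ≃o ↥(⋃ m, layer e m)) := by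
    rw [he.iUnion_layer]
    exact hext.exists_orderIso (hext.compl_range e)
  obtain ⟨φ⟩ := hunion
  have hY : ∀ m, layerInUnion e m ∈ copies ↥(⋃ m, layer e m) := fun m =>
    mem_copies_iff.2 ⟨(φ.symm.trans (hlayer m).some).trans (layerInUnionOrderIso e m)⟩
  refine ⟨e, hmax, hmin, fun m => mem_copies_iff.2 (hlayer m), fun m n => disjoint_layer e,
    mem_copies_iff.2 ⟨φ⟩, fun m => ⟨_, hY m⟩, image_layerInUnion e, ?_, ?_⟩
  · rintro _ ⟨m, rfl⟩ _ ⟨n, rfl⟩ hne hcomp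
    have hmn : m ≠ n := by
      rintro rfl
      exact hne rfl
    obtain ⟨f, hf⟩ := compatible_copies_iff.1 hcomp
    obtain ⟨h1, h2⟩ := hf (φ a₀)
    exact Set.disjoint_left.1 (disjoint_layer e hmn) h1 h2
  · rintro ⟨_, f, rfl⟩
    have : DenselyOrdered ↥(⋃ m, layer e m) := (denselyOrdered_iff_of_orderIsoClass φ).1 ‹_›
    let f' : ↥(⋃ m, layer e m) ↪o D := f.trans (OrderEmbedding.subtype (· ∈ ⋃ m, layer e m))
    obtain ⟨m, x, y, -, hxy, -, hx, hy, -⟩ :=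
      he.exists_chain_mem_layer f' (φ.lt_iff_lt.2 hab₀)
    -- The union is identified with `D` through `φ`, so the interval from `x` to `y` contains a copy
    -- of the union, which `f` carries into layer `m`.
    obtain ⟨k⟩ := (hhom.forthProperty_Ioo hext.isBidirected
      (φ.symm.lt_iff_lt.2 hxy)).exists_embedding
    let k' := (φ.symm.toOrderEmbedding.trans
      (k.trans (OrderEmbedding.subtype _))).trans φ.toOrderEmbedding
    refine ⟨_, ⟨m, rfl⟩, compatible_copies_iff.2 ⟨k'.trans f, fun z => ⟨⟨_, rfl⟩, ?_⟩⟩⟩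
    have hk1 : x < k' z := (φ.symm_apply_lt).1 (k (φ.symm z)).2.1
    have hk2 : k' z < y := (φ.lt_symm_apply).1 (k (φ.symm z)).2.2
    have h1 : f' x < f' (k' z) := f'.lt_iff_lt.2 hk1
    have h2 : f' (k' z) < f' y := f'.lt_iff_lt.2 hk2
    exact ⟨h2.trans hy.1, fun h' => hx.2 (h1.le.trans h')⟩

theorem IsRandomPoset.infinite (h : IsRandomPoset D) : Infinite D := by
  have hext := h.hasExtensionProperty
  have := hext.nonempty
  have : NoMaxOrder D := ⟨hext.exists_gt⟩
  exact NoMaxOrder.infinite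

theorem IsRandomPoset.hasCountableMaximalAntichain (h : IsRandomPoset D) :
    HasCountableMaximalAntichain D := by
  have hext := h.hasExtensionProperty
  have := h.1
  obtain ⟨a⟩ := hext.nonempty
  obtain ⟨b, hb⟩ := hext.exists_gt a
  exact h.2.1.hasCountableMaximalAntichain_of_isBidirected ⟨a, b, hb⟩ hext.isBidirected

end RandomPoset

end PosetCopies

theorem theorem1p3 :
    (∀ (X : Type u) [PartialOrder X] [Countable X] [Infinite X],
      PosetCopies.IsUltrahomogeneous X →
        (∃ 𝒜 : Set (PosetCopies.copies X),
          PosetCopies.IsMaximalForcingAntichain 𝒜 ∧ Cardinal.mk 𝒜 = Cardinal.continuum) ∧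
        ((∃ 𝒜 : Set (PosetCopies.copies X),
          PosetCopies.IsMaximalForcingAntichain 𝒜 ∧ Cardinal.mk 𝒜 = Cardinal.aleph0) ↔
            ¬ Nonempty (X ≃o PosetCopies.AOmega) ∧ ¬ Nonempty (X ≃o PosetCopies.BOmega))) ∧
    (∀ (D : Type u) [PartialOrder D], PosetCopies.IsRandomPoset D →
        (∃ 𝒜 : Set (PosetCopies.copies D),
          PosetCopies.IsMaximalForcingAntichain 𝒜 ∧ Cardinal.mk 𝒜 = Cardinal.continuum) ∧
        (∃ 𝒜 : Set (PosetCopies.copies D),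
          PosetCopies.IsMaximalForcingAntichain 𝒜 ∧ Cardinal.mk 𝒜 = Cardinal.aleph0) ∧
        ∃ e : ℤ ↪o D,
          ¬ BddAbove (Set.range e) ∧ ¬ BddBelow (Set.range e) ∧
          (∀ m : ℤ, PosetCopies.layer e m ∈ PosetCopies.copies D) ∧
          (∀ m n : ℤ, m ≠ n → Disjoint (PosetCopies.layer e m) (PosetCopies.layer e n)) ∧
          (⋃ m : ℤ, PosetCopies.layer e m) ∈ PosetCopies.copies D ∧
          ∃ Y : ℤ → PosetCopies.copies ↥(⋃ m : ℤ, PosetCopies.layer e m),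
            (∀ m : ℤ, Subtype.val '' (Y m).val = PosetCopies.layer e m) ∧
            PosetCopies.IsMaximalForcingAntichain (Set.range Y)) := by
  refine ⟨fun X _ _ _ h => ⟨h.exists_maximal_continuum, ?_⟩, fun D _ h => ?_⟩
  · rw [← PosetCopies.hasCountableMaximalAntichain_iff]
    exact h.hasCountableMaximalAntichain_iff
  · have := h.1
    have := h.infinite
    exact ⟨h.2.1.exists_maximal_continuum, PosetCopies.hasCountableMaximalAntichain_iff.1
      h.hasCountableMaximalAntichain, h.exists_layers⟩
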